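/- All hypergraphs are finite and have no repeated hyperedges; an $r$-graph is a hypergraph in which every hyperedge has exactly $r$ vertices. A Berge cycle of length $t$ ($t\ge 2$) in a hypergraph consists of distinct vertices $v_0,\dots,v_{t-1}$ and distinct hyperedges $e_1,\dots,e_t$ with $v_{i-1},v_i\in e_i$ for $1\le i\le t$, where $v_t=v_0$. Let $\mathrm{ex}_r(n,\mathcal{BC}_{\ge r})$ be the maximum number of hyperedges of an $n$-vertex $r$-graph that contains no Berge cycle of length at least $r$; an $n$-vertex $r$-graph with no such cycle that attains this maximum is called extremal. The $r$-star $\mathcal S_n^{(r)}$ ($n\ge r$) has vertices $v_1,\dots,v_n$ and hyperedges $\{v_1,\dots,v_{r-1},v_i\}$, $r\le i\le n$. The $2$-shadow of a hypergraph is the graph on the same vertex set in which two distinct vertices are adjacent if they lie in a common hyperedge. An $r$-graph is an $(r+1,r-1)$-block tree if its $2$-shadow is connected and every $2$-connected block (maximal $2$-connected subgraph, with at least three vertices) of the $2$-shadow has exactly $r+1$ vertices, which induce exactly $r-1$ hyperedges. Theorem. Let $r>2$ and $n\ge 1$ be integers. Then $$\mathrm{ex}_r(n,\mathcal{BC}_{\ge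 r})=\max\left\{\left\lfloor\frac{n-1}{r}\right\rfloor(r-1),\; n-r+1\right\}.$$ Moreover: (a) If $n-r+1>\left\lfloor\frac{n-1}{r}\right\rfloor(r-1)$, then the extremal $n$-vertex $r$-graphs are exactly those isomorphic to $\mathcal S_n^{(r)}$. (b) If $\left\lfloor\frac{n-1}{r}\right\rfloor(r-1)>n-r+1$ and $r\mid n-1$, then the extremal $n$-vertex $r$-graphs are exactly the $n$-vertex $(r+1,r-1)$-block trees. -/

import Mathlib

open scoped Hypergraph

namespace BergeTuran

/-- `H` is an `r`-uniform hypergraph (an `r`-graph): every hyperedge has exactly `r` vertices.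
(Hypergraphs in the sense of `Hypergraph` have no repeated hyperedges.) -/
def IsUniform {α : Type*} (H : Hypergraph α) (r : ℕ) : Prop :=
  ∀ e ∈ E(H), e.encard = r

/-- A Berge cycle of length `t ≥ 2`: distinct vertices `v 0, …, v (t - 1)` and distinct hyperedges
`e 0, …, e (t - 1)` of `H` such that `e i` contains `v i` and `v (i + 1)`, indices modulo `t`
(`finRotate t` is the cyclic successor on `Fin t`). -/
def HasBergeCycle {α : Type*} (H : Hypergraph α) (t : ℕ) : Prop :=
  2 ≤ t ∧ ∃ (v : Fin t → α) (e : Fin t → Set α),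
    Function.Injective v ∧ Function.Injective e ∧
      ∀ i, e i ∈ E(H) ∧ v i ∈ e i ∧ v (finRotate t i) ∈ e i

/-- `H` contains no Berge cycle of length at least `k`. -/
def BergeCycleFree {α : Type*} (H : Hypergraph α) (k : ℕ) : Prop :=
  ∀ t, k ≤ t → ¬ HasBergeCycle H t

/-- The possible numbers of hyperedges of an `r`-graph on the `n` vertices `Fin n` without Berge
cycles of length at least `k`. -/
def edgeNumbers (n r k : ℕ) : Set ℕ :=
  {m | ∃ H : Hypergraph (Fin n), V(H) = Set.univ ∧ IsUniform H r ∧ BergeCycleFree H k ∧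
    E(H).ncard = m}

/-- The Turán number: the maximum number of hyperedges of an `n`-vertex `r`-graph without Berge
cycles of length at least `k`. -/
noncomputable def exBerge (n r k : ℕ) : ℕ := sSup (edgeNumbers n r k)

/-- The supremum in the definition of the Turán number is always an attained maximum. -/
theorem exBerge_isGreatest (n r k : ℕ) : IsGreatest (edgeNumbers n r k) (exBerge n r k) := by
  have hne : (edgeNumbers n r k).Nonempty := by
    refine ⟨0, Hypergraph.trivialOn Set.univ, rfl, ?_, ?_, ?_⟩
    · intro e he
      simp at he
    · rintro t - ⟨ht, v, e, -, -, h⟩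
      have := (h ⟨0, by omega⟩).1
      simp at this
    · simp
  have hb : BddAbove (edgeNumbers n r k) := by
    refine ⟨Nat.card (Set (Fin n)), ?_⟩
    rintro m ⟨H, -, -, -, rfl⟩
    exact Set.ncard_le_card _
  exact ⟨Nat.sSup_mem hne hb, fun m hm => le_csSup hb hm⟩

/-- `H` is an extremal hypergraph: an `n`-vertex `r`-graph without Berge cycles of length at least
`k` that has the maximum possible number of hyperedges. -/
def IsExtremal {α : Type*} (H : Hypergraph α) (n r k : ℕ) : Prop :=
  V(H).encard = n ∧ IsUniform H r ∧ BergeCycleFree H k ∧ E(H).ncard = exBerge n r k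

/-- Isomorphism of hypergraphs: a bijection of the vertex sets that carries hyperedges to
hyperedges in both directions. -/
def IsIsomorphic {α β : Type*} (H : Hypergraph α) (H' : Hypergraph β) : Prop :=
  ∃ φ : V(H) ≃ V(H'), ∀ S : Set V(H),
    Subtype.val '' S ∈ E(H) ↔ Subtype.val '' (φ '' S) ∈ E(H')

/-- The `r`-star on the vertices `0, …, n - 1`: the hyperedges are the sets
`{0, …, r - 2} ∪ {i}` with `r - 1 ≤ i < n`. -/
def star (n r : ℕ) : Hypergraph (Fin n) where
  vertexSet := Set.univ
  edgeSet := {e | ∃ i : Fin n, r - 1 ≤ (i : ℕ) ∧ e = insert i {j : Fin n | (j : ℕ) < r - 1}}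
  subset_vertexSet_of_mem_edgeSet' := fun e _ => Set.subset_univ e

/-- The 2-shadow of `H`, as a graph on the vertex set of `H`: two distinct vertices are adjacent
when they lie in a common hyperedge. -/
def shadow {α : Type*} (H : Hypergraph α) : SimpleGraph V(H) where
  Adj x y := x ≠ y ∧ H.Adj (x : α) (y : α)
  symm := ⟨fun _ _ h => ⟨h.1.symm, h.2.symm⟩⟩
  loopless := ⟨fun _ h => h.1 rfl⟩

/-- A graph is 2-connected if it has at least three vertices, is connected, and stays connected
after the deletion of any one vertex. -/
def IsTwoConnected {W : Type*} (G : SimpleGraph W) : Prop :=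
  3 ≤ ENat.card W ∧ G.Connected ∧ ∀ v : W, (G.induce {v}ᶜ).Connected

/-- `B` is the vertex set of a 2-connected block of `G`: a maximal set of vertices that induces a
2-connected subgraph (a maximal 2-connected subgraph is always induced). -/
def IsTwoConnectedBlock {W : Type*} (G : SimpleGraph W) (B : Set W) : Prop :=
  Maximal (fun B : Set W => IsTwoConnected (G.induce B)) B

/-- `H` is an `(s, m)`-block tree: its 2-shadow is connected, and every 2-connected block of the
2-shadow consists of `s` vertices that induce exactly `m` hyperedges of `H`.  The notion is applied
to `r`-graphs with `r ≥ 3`, whose 2-shadow has no bridges (every pair in it lies in a triangle), so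
that the blocks with at least one edge are exactly the 2-connected ones. -/
def IsBlockTree {α : Type*} (H : Hypergraph α) (s m : ℕ) : Prop :=
  (shadow H).Connected ∧
    ∀ B : Set V(H), IsTwoConnectedBlock (shadow H) B →
      B.encard = s ∧ {e ∈ E(H) | e ⊆ Subtype.val '' B}.encard = m

end BergeTuran

open scoped Hypergraph

namespace BergeTuran

/-! The upper bound follows by induction on the number of vertices, deleting a part that meets few
hyperedges. Either some `r` vertices meet at most `r - 1` hyperedges (`HasSparseSet`), which the
first term of the maximum pays for, or a proper subset `D` of the vertices meets at most `|D| - r +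
2` hyperedges (`HasStarSet`). In the second case the other `n - |D|` vertices carry at most `n - |D|
- 1` hyperedges, and the sum is `n - r + 1`.

The dichotomy `sparse_or_star` comes from a longest Berge path that starts and ends with a
hyperedge. Pósa-type rotations at its beginning keep the set `F` of its first `r - 1` hyperedges (of
all, if the path is shorter), because there are no long cycles. A vertex that is free in the first
hyperedge of some longest path with front `F` is an end (`ends`); ends lie in hyperedges of `F`
only, so `r` of them form a sparse set. With fewer ends, the count in `ends_structure` is tight.
Then either the first hyperedge has `r - 1` vertices of degree one (`pendant_of_card_back_lt`), or
the front consists of a core of `r - 1` vertices with one private vertex per hyperedge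
(`starFront_of_card_back`). A core leads to a star set or a sparse set; two pendant ends of the path
contain a sparse set.

If the linear term is attained and strictly larger, the induction leaves room only for a star set
that misses one vertex, apart from the trivial case of `r` vertices, and all hyperedges share `r -
1` vertices. If `n = q * r + 1` and the other term is strictly larger, then `q + 2 < r` and star
sets are too expensive, so sparse sets are peeled off repeatedly. In what remains, any two vertices
are joined by a Berge path with at least `r - 1` hyperedges (`LongLinked`); a part attached at two
vertices would close a long cycle, so each peeled part hangs on one cut vertex
(`exists_attachment`). Conversely, a Berge cycle spans a 2-connected set, so it lies in one block,
which has only `r - 1` hyperedges. -/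

/-- A finite family of finite sets contains no Berge cycle of length at least `r`. -/
def CycleFree {α : Type*} (E : Finset (Finset α)) (r : ℕ) : Prop :=
  ∀ t, r ≤ t → ∀ (e : ℕ → Finset α) (v : ℕ → α), (∀ i < t, e i ∈ E) →
    (∀ i < t, ∀ j < t, e i = e j → i = j) → (∀ i < t, ∀ j < t, v i = v j → i = j) →
    (∀ i < t, v i ∈ e i) → (∀ i, i + 1 < t → v i ∈ e (i + 1)) → v (t - 1) ∈ e 0 → False

/-- A Berge path `e 0, v 0, e 1, v 1, …, e (m - 1)` that starts and ends with a hyperedge. -/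
structure IsPath {α : Type*} (E : Finset (Finset α)) (m : ℕ) (e : ℕ → Finset α) (v : ℕ → α) :
    Prop where
  mem : ∀ i < m, e i ∈ E
  einj : ∀ i < m, ∀ j < m, e i = e j → i = j
  vinj : ∀ i, i + 1 < m → ∀ j, j + 1 < m → v i = v j → i = j
  left : ∀ i, i + 1 < m → v i ∈ e i
  right : ∀ i, i + 1 < m → v i ∈ e (i + 1)

/-- `x` is none of the vertices that link the `m` hyperedges of a path. -/
def Off {α : Type*} (m : ℕ) (v : ℕ → α) (x : α) : Prop := ∀ i, i + 1 < m → x ≠ v i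

/-! ### Berge paths and their rotations -/

section Paths

variable {α : Type*} {E : Finset (Finset α)} {m r : ℕ} {e : ℕ → Finset α} {v : ℕ → α}

/-- The link `v i` closes the initial segment `e 0, …, e i` to a cycle of length `i + 1`. -/
theorem IsPath.lt_of_mem_first (h : IsPath E m e v) (hE : CycleFree E r) {i : ℕ}
    (hi : i + 1 < m) (hv : v i ∈ e 0) : i + 1 < r := by
  by_contra hr
  refine hE (i + 1) (by omega) e v (fun j hj => h.mem j (by omega))
    (fun j hj k hk => h.einj j (by omega) k (by omega))
    (fun j hj k hk => h.vinj j (by omega) k (by omega))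
    (fun j hj => h.left j (by omega)) (fun j hj => h.right j (by omega)) (by simpa using hv)

/-- Taken as the last cycle vertex, `x` closes `e 0, …, e k` to a cycle of length `k + 1`. -/
theorem IsPath.lt_of_off (h : IsPath E m e v) (hE : CycleFree E r) {k : ℕ} {x : α}
    (hk : k < m) (hx : Off m v x) (hx0 : x ∈ e 0) (hxk : x ∈ e k) : k + 1 < r := by
  by_contra hr
  refine hE (k + 1) (by omega) e (fun i => if i = k then x else v i)
    (fun j hj => h.mem j (by omega))
    (fun j hj k hk => h.einj j (by omega) k (by omega)) ?_ ?_ ?_ (by simpa using hx0)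
  · intro i hi j hj hij
    have := h.vinj i
    have := hx i
    have := hx j
    grind
  · intro i hi
    have := h.left i
    grind
  · intro i hi
    have := h.right i
    grind

/-- Here `v a` closes the segment `e (a + 1), …, e b`, which has `b - a` hyperedges. -/
theorem IsPath.sub_lt (h : IsPath E m e v) (hE : CycleFree E r) {a b : ℕ}
    (hab : a + 1 < b) (hb : b < m) (hv : v a ∈ e b) : b - a < r := by
  by_contra hr
  refine hE (b - a) (by omega) (fun i => e (a + 1 + i))
    (fun i => if i + 1 = b - a then v a else v (a + 1 + i))
    (fun j hj => h.mem _ (by omega))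
    (fun j hj k hk hjk => by have := h.einj _ (by omega) _ (by omega) hjk; omega) ?_ ?_ ?_ ?_
  · intro i hi j hj hij
    have h1 := h.vinj (if i + 1 = b - a then a else a + 1 + i) (by split_ifs <;> omega)
      (if j + 1 = b - a then a else a + 1 + j) (by split_ifs <;> omega) (by grind)
    split_ifs at h1 <;> omega
  · intro i hi
    have := h.left (a + 1 + i)
    grind
  · intro i hi
    have := h.right (a + 1 + i)
    grind
  · have := h.right a (by omega)
    rw [if_pos (by omega)]
    simpa using this

/-- Rotation at a linking vertex that lies in the first hyperedge. -/
theorem IsPath.rotate (h : IsPath E m e v) {i : ℕ} (hi : i + 1 < m) (hv : v i ∈ e 0) :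
    IsPath E m (fun j => if j ≤ i then e (i - j) else e j)
      (fun j => if j < i then v (i - 1 - j) else v j) := by
  -- The new path is `e i, v (i - 1), …, v 0, e 0, v i, e (i + 1), …`.
  constructor
  · intro j hj
    have := h.mem (i - j)
    have := h.mem j
    grind
  · intro j hj k hk hjk
    have h1 := h.einj (if j ≤ i then i - j else j) (by split_ifs <;> omega)
      (if k ≤ i then i - k else k) (by split_ifs <;> omega) (by grind)
    split_ifs at h1 <;> omega
  · intro j hj k hk hjk
    have h1 := h.vinj (if j < i then i - 1 - j else j) (by split_ifs <;> omega)
      (if k < i then i - 1 - k else k) (by split_ifs <;> omega) (by grind)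
    split_ifs at h1 <;> omega
  · intro j hj
    rcases lt_trichotomy j i with hji | hji | hji
    · have := h.right (i - 1 - j) (by omega)
      rw [show i - 1 - j + 1 = i - j by omega] at this
      simpa [hji, hji.le] using this
    · subst hji
      simpa using hv
    · simpa [not_lt.2 hji.le, not_le.2 hji] using h.left j hj
  · intro j hj
    rcases lt_or_ge j i with hji | hji
    · have := h.left (i - 1 - j) (by omega)
      rw [show i - 1 - j = i - (j + 1) by omega] at this
      simpa [hji, Nat.succ_le_of_lt hji, show i - 1 - j = i - (j + 1) by omega] using this
    · simpa [not_lt.2 hji, show ¬ j + 1 ≤ i by omega] using h.right j hj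

/-- Rotation at a vertex outside the path that lies in the first hyperedge and in a later one. -/
theorem IsPath.swap (h : IsPath E m e v) {k : ℕ} {x : α} (hk : k + 1 < m) (hx : Off m v x)
    (hx0 : x ∈ e 0) (hxk : x ∈ e (k + 1)) :
    IsPath E m (fun j => if j ≤ k then e (k - j) else e j)
      (fun j => if j < k then v (k - 1 - j) else if j = k then x else v j) := by
  -- The new path is `e k, v (k - 1), …, v 0, e 0, x, e (k + 1), …`, in which `x` replaces the link
  -- `v k`.
  constructor
  · intro j hj
    have := h.mem (k - j)
    have := h.mem j
    grind
  · intro j hj i hi hjk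
    have h1 := h.einj (if j ≤ k then k - j else j) (by split_ifs <;> omega)
      (if i ≤ k then k - i else i) (by split_ifs <;> omega) (by grind)
    split_ifs at h1 <;> omega
  · intro j hj i hi hjk
    by_cases h2 : j = k
    · have := hx (if i < k then k - 1 - i else i) (by split_ifs <;> omega)
      grind
    by_cases h3 : i = k
    · have := hx (if j < k then k - 1 - j else j) (by split_ifs <;> omega)
      grind
    have h1 := h.vinj (if j < k then k - 1 - j else j) (by split_ifs <;> omega)
      (if i < k then k - 1 - i else i) (by split_ifs <;> omega) (by grind)
    split_ifs at h1 <;> omega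
  · intro j hj
    rcases lt_trichotomy j k with hji | hji | hji
    · have := h.right (k - 1 - j) (by omega)
      rw [show k - 1 - j + 1 = k - j by omega] at this
      simpa [hji, hji.le] using this
    · subst hji
      simpa using hx0
    · simpa [not_lt.2 hji.le, not_le.2 hji, hji.ne'] using h.left j hj
  · intro j hj
    rcases lt_trichotomy j k with hji | hji | hji
    · have := h.left (k - 1 - j) (by omega)
      rw [show k - 1 - j = k - (j + 1) by omega] at this
      simpa [hji, Nat.succ_le_of_lt hji, show k - 1 - j = k - (j + 1) by omega] using this
    · subst hji
      simpa using hxk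
    · simpa [not_lt.2 hji.le, hji.ne', show ¬ j + 1 ≤ k by omega] using h.right j hj

theorem IsPath.reverse (h : IsPath E m e v) :
    IsPath E m (fun j => e (m - 1 - j)) (fun j => v (m - 2 - j)) := by
  constructor
  · intro j hj
    exact h.mem _ (by omega)
  · intro j hj i hi hij
    have := h.einj _ (by omega) _ (by omega) hij
    omega
  · intro j hj i hi hij
    have := h.vinj _ (by omega) _ (by omega) hij
    omega
  · intro j hj
    have := h.right (m - 2 - j) (by omega)
    rwa [show m - 2 - j + 1 = m - 1 - j by omega] at this
  · intro j hj
    have := h.left (m - 2 - j) (by omega)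
    rwa [show m - 1 - (j + 1) = m - 2 - j by omega]

theorem IsPath.cons (h : IsPath E m e v) {f : Finset α} {x : α} (hf : f ∈ E)
    (hfe : ∀ i < m, f ≠ e i) (hx : Off m v x) (hx0 : x ∈ e 0) (hxf : x ∈ f) :
    IsPath E (m + 1) (fun j => if j = 0 then f else e (j - 1))
      (fun j => if j = 0 then x else v (j - 1)) := by
  constructor
  · intro j hj
    have := h.mem (j - 1)
    grind
  · intro j hj i hi hij
    have := h.einj (j - 1)
    have := hfe (j - 1)
    have := hfe (i - 1)
    grind
  · intro j hj i hi hij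
    have := h.vinj (j - 1)
    have := hx (j - 1)
    have := hx (i - 1)
    grind
  · intro j hj
    rcases j with _ | j
    · simpa using hxf
    · simpa using h.left j (by omega)
  · intro j hj
    rcases j with _ | j
    · simpa using hx0
    · simpa using h.right j (by omega)

/-- The exchange of `v k` for `x` frees `v k`, which lies in the new first hyperedge `e k`. In this
way a linking vertex becomes an end. -/
theorem off_swap (h : IsPath E m e v) {k : ℕ} {x : α} (hk : k + 1 < m) (hx : Off m v x) :
    Off m (fun j => if j < k then v (k - 1 - j) else if j = k then x else v j) (v k) := by
  intro j hj hv
  have := hx k hk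
  have h1 := h.vinj k hk (if j < k then k - 1 - j else j) (by split_ifs <;> omega) (by grind)
  grind

end Paths

/-! ### Ends of longest paths with a fixed front -/

section Ends

open Finset

/-- A length `m` such that no Berge path has more than `m` hyperedges, in an `r`-graph without Berge
cycles of length at least `r`. -/
structure LongestLength {α : Type*} (E : Finset (Finset α)) (m r : ℕ) : Prop where
  two_lt : 2 < r
  two_le : 2 ≤ m
  unif : ∀ f ∈ E, f.card = r
  free : CycleFree E r
  max : ∀ e v, ¬ IsPath E (m + 1) e v

variable {α : Type*} [DecidableEq α] {E F : Finset (Finset α)} {m r : ℕ}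
  {e : ℕ → Finset α} {v : ℕ → α}

/-- The vertices linking the hyperedges of a path. -/
def link (m : ℕ) (v : ℕ → α) : Finset α := (range (m - 1)).image v

/-- The indices of the linking vertices that lie in the first hyperedge. -/
def back (m : ℕ) (e : ℕ → Finset α) (v : ℕ → α) : Finset ℕ :=
  (range (m - 1)).filter fun i => v i ∈ e 0

/-- The vertices of the `k`-th hyperedge that are not linking vertices. -/
def outer (m : ℕ) (e : ℕ → Finset α) (v : ℕ → α) (k : ℕ) : Finset α := e k \ link m v

/-- Paths with `m` hyperedges with a prescribed set of front hyperedges. -/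
def InClass (E : Finset (Finset α)) (m r : ℕ) (F : Finset (Finset α)) (e : ℕ → Finset α)
    (v : ℕ → α) : Prop :=
  IsPath E m e v ∧ (range (min m (r - 1))).image e = F

open Classical in
/-- The vertices outside a path of the class that lie in its first hyperedge. -/
noncomputable def ends (E : Finset (Finset α)) (m r : ℕ) (F : Finset (Finset α)) : Finset α :=
  (E.biUnion id).filter fun x => ∃ e v, InClass E m r F e v ∧ x ∈ e 0 ∧ Off m v x

theorem off_iff {x : α} : Off m v x ↔ x ∉ link m v := by
  simp only [Off, link, mem_image, mem_range, not_exists, not_and]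
  constructor
  · intro h i hi hx
    exact h i (by omega) hx.symm
  · intro h i hi hx
    exact h i (by omega) hx.symm

theorem mem_back {i : ℕ} : i ∈ back m e v ↔ i + 1 < m ∧ v i ∈ e 0 := by
  simp only [back, mem_filter, mem_range]
  constructor <;> rintro ⟨h, h'⟩ <;> exact ⟨by omega, h'⟩

theorem mem_link {p : ℕ} (h : p + 1 < m) : v p ∈ link m v :=
  mem_image.2 ⟨p, mem_range.2 (by omega), rfl⟩

theorem image_reverse {β : Type*} [DecidableEq β] (f : ℕ → β) {k b : ℕ} (hk : k < b) :
    (range b).image (fun j => if j ≤ k then f (k - j) else f j) = (range b).image f := by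
  ext x
  simp only [mem_image, mem_range]
  constructor
  · rintro ⟨j, hj, rfl⟩
    refine ⟨if j ≤ k then k - j else j, by split_ifs <;> omega, by split_ifs <;> rfl⟩
  · rintro ⟨j, hj, rfl⟩
    refine ⟨if j ≤ k then k - j else j, by split_ifs <;> omega, ?_⟩
    grind

theorem link_rotate {i : ℕ} (hi : i + 1 < m) :
    link m (fun j => if j < i then v (i - 1 - j) else v j) = link m v := by
  rcases i with _ | i
  · simp
  · rw [link, link, ← image_reverse v (show i < m - 1 by omega)]
    congr 1
    ext j
    simp

/-- Without cycles of length at least `r`, a back link has index below `r - 1`; the reversal thus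
takes place inside the front and preserves `F`. -/
theorem InClass.rotate (h : InClass E m r F e v) (hE : CycleFree E r) {i : ℕ}
    (hi : i ∈ back m e v) :
    InClass E m r F (fun j => if j ≤ i then e (i - j) else e j)
      (fun j => if j < i then v (i - 1 - j) else v j) := by
  obtain ⟨him, hiv⟩ := mem_back.1 hi
  refine ⟨h.1.rotate him hiv, ?_⟩
  have := h.1.lt_of_mem_first hE him hiv
  rw [image_reverse e (show i < min m (r - 1) by omega)]
  exact h.2

theorem InClass.swap (h : InClass E m r F e v) (hE : CycleFree E r) {k : ℕ} {x : α}
    (hk : k + 1 < m) (hx : Off m v x) (hx0 : x ∈ e 0) (hxk : x ∈ e (k + 1)) :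
    InClass E m r F (fun j => if j ≤ k then e (k - j) else e j)
      (fun j => if j < k then v (k - 1 - j) else if j = k then x else v j) := by
  refine ⟨h.1.swap hk hx hx0 hxk, ?_⟩
  have := h.1.lt_of_off hE hk hx hx0 hxk
  rw [image_reverse e (show k < min m (r - 1) by omega)]
  exact h.2

theorem LongestLength.mem_ends (hs : LongestLength E m r) (h : InClass E m r F e v) {x : α}
    (hx : x ∈ outer m e v 0) : x ∈ ends E m r F := by
  classical
  have hm := hs.two_le
  obtain ⟨hx0, hx1⟩ := mem_sdiff.1 hx
  exact mem_filter.2 ⟨mem_biUnion.2 ⟨e 0, h.1.mem 0 (by omega), hx0⟩, e, v, h, hx0, off_iff.2 hx1⟩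

/-- A hyperedge through an end lies on the path, since it would otherwise extend a longest one, and
its index is below `r - 1`, since it would otherwise close a long cycle. -/
theorem LongestLength.mem_front (hs : LongestLength E m r) {x : α} (hx : x ∈ ends E m r F)
    {g : Finset α} (hg : g ∈ E) (hxg : x ∈ g) : g ∈ F := by
  classical
  obtain ⟨-, e, v, h, hx0, hoff⟩ := mem_filter.1 hx
  have hm := hs.two_le
  by_cases hge : ∃ i < m, g = e i
  · obtain ⟨i, hi, rfl⟩ := hge
    have := h.1.lt_of_off hs.free hi hoff hx0 hxg
    rw [← h.2]
    exact mem_image_of_mem e (mem_range.2 (by omega))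
  · push Not at hge
    exact absurd (h.1.cons hg hge hoff hx0 hxg) (hs.max _ _)

theorem InClass.card_le (h : InClass E m r F e v) : F.card ≤ r - 1 := by
  rw [← h.2]
  refine card_image_le.trans ?_
  simp

theorem outer_mem_ends (hs : LongestLength E m r) (h : InClass E m r F e v) {k : ℕ}
    (hk : k ∈ back m e v) : outer m e v k ⊆ ends E m r F := by
  intro x hx
  refine hs.mem_ends (h.rotate hs.free hk) ?_
  rw [outer, link_rotate (mem_back.1 hk).1]
  simpa [outer] using hx

theorem zero_mem_back (hs : LongestLength E m r) (h : InClass E m r F e v) : 0 ∈ back m e v :=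
  have hm := hs.two_le
  mem_back.2 ⟨by omega, h.1.left 0 (by omega)⟩

/-- A vertex outside the path in two hyperedges, the first of which can be rotated to the front,
makes the vertex before the second one an end. -/
theorem mem_ends_of_not_disjoint (hs : LongestLength E m r) (h : InClass E m r F e v) {i k : ℕ}
    (hi : i ∈ back m e v) (hik : i < k + 1) (hk : k + 1 < m) {x : α}
    (hxi : x ∈ outer m e v i) (hxk : x ∈ outer m e v (k + 1)) : v k ∈ ends E m r F := by
  have h' := h.rotate hs.free hi
  have hoff : Off m (fun j => if j < i then v (i - 1 - j) else v j) x := by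
    rw [off_iff, link_rotate (mem_back.1 hi).1]
    exact (mem_sdiff.1 hxi).2
  -- As `i ≤ k`, the rotation leaves `v k` and `e (k + 1)` in place; the exchange at `x` then frees
  -- `v k`.
  have h2 := h'.swap hs.free (k := k) hk hoff (by simpa using (mem_sdiff.1 hxi).1)
    (by simpa [show ¬ k + 1 ≤ i by omega] using (mem_sdiff.1 hxk).1)
  refine hs.mem_ends h2 (mem_sdiff.2 ⟨?_, ?_⟩)
  · have := h'.1.left k hk
    simpa [show ¬ k < i by omega] using this
  · rw [← off_iff]
    have := off_swap h'.1 hk hoff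
    simpa [show ¬ k < i by omega] using this

theorem card_outer_zero (hs : LongestLength E m r) (h : InClass E m r F e v) :
    (outer m e v 0).card + (back m e v).card = r := by
  have hm := hs.two_le
  have h1 : (outer m e v 0).card + (e 0 ∩ link m v).card = (e 0).card :=
    card_sdiff_add_card_inter _ _
  have h2 : e 0 ∩ link m v = (back m e v).image v := by
    ext x
    simp only [mem_inter, link, mem_image, mem_range, back, mem_filter]
    constructor
    · rintro ⟨h1, i, hi, rfl⟩
      exact ⟨i, ⟨hi, h1⟩, rfl⟩
    · rintro ⟨i, ⟨hi, h1⟩, rfl⟩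
      exact ⟨h1, i, hi, rfl⟩
  rw [h2, card_image_of_injOn, hs.unif _ (h.1.mem 0 (by omega))] at h1
  · exact h1
  · intro i hi j hj hij
    exact h.1.vinj i (mem_back.1 hi).1 j (mem_back.1 hj).1 hij

theorem back_subset (hs : LongestLength E m r) (h : InClass E m r F e v) :
    back m e v ⊆ range (r - 1) := by
  intro i hi
  have := h.1.lt_of_mem_first hs.free (mem_back.1 hi).1 (mem_back.1 hi).2
  exact mem_range.2 (by omega)

theorem card_back_le (hs : LongestLength E m r) (h : InClass E m r F e v) :
    (back m e v).card ≤ r - 1 := by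
  simpa using card_le_card (back_subset hs h)

theorem outer_rotate {i : ℕ} (hi : i ∈ back m e v) :
    outer m (fun j => if j ≤ i then e (i - j) else e j)
      (fun j => if j < i then v (i - 1 - j) else v j) 0 = outer m e v i := by
  rw [outer, outer, link_rotate (mem_back.1 hi).1]
  simp

/-- Once rotated to the front, the hyperedge contains at most `r - 1` linking vertices, so one of
its `r` vertices is free. -/
theorem outer_nonempty (hs : LongestLength E m r) (h : InClass E m r F e v) {k : ℕ}
    (hk : k ∈ back m e v) : (outer m e v k).Nonempty := by
  have h1 := card_outer_zero hs (h.rotate hs.free hk)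
  have h2 := card_back_le hs (h.rotate hs.free hk)
  have := hs.two_lt
  rw [outer_rotate hk] at h1
  rw [← card_pos]
  omega

/-- The outer part of the `k`-th hyperedge is disjoint from those of the earlier hyperedges that can
be rotated to the front. -/
def Fresh (m : ℕ) (e : ℕ → Finset α) (v : ℕ → α) (k : ℕ) : Prop :=
  ∀ i ∈ back m e v, i < k → Disjoint (outer m e v i) (outer m e v k)

theorem mem_ends_of_not_fresh (hs : LongestLength E m r) (h : InClass E m r F e v) {k : ℕ}
    (hk : k + 1 < m) (hf : ¬ Fresh m e v (k + 1)) : v k ∈ ends E m r F := by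
  simp only [Fresh, not_forall] at hf
  obtain ⟨i, hi, hik, hd⟩ := hf
  obtain ⟨x, hx, hx'⟩ := not_disjoint_iff.1 hd
  exact mem_ends_of_not_disjoint hs h hi hik hk hx hx'

/-- If there are few ends, then they are determined by the path. -/
theorem ends_structure (hs : LongestLength E m r) (h : InClass E m r F e v)
    (hS : (ends E m r F).card ≤ r - 1) :
    (∀ k ∈ back m e v, k ≠ 0 → Fresh m e v k → (outer m e v k).card = 1) ∧
    (∀ p, p + 1 < m → v p ∈ ends E m r F → p + 1 ∈ back m e v ∧ ¬ Fresh m e v (p + 1)) ∧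
    (∀ y ∈ ends E m r F, y ∉ link m v →
      y ∈ outer m e v 0 ∨ ∃ k ∈ back m e v, k ≠ 0 ∧ Fresh m e v k ∧ y ∈ outer m e v k) := by
  classical
  have h0 := zero_mem_back hs h
  have : ∀ k, ∃ x, k ∈ back m e v → x ∈ outer m e v k := fun k => by
    by_cases hk : k ∈ back m e v
    · obtain ⟨x, hx⟩ := outer_nonempty hs h hk
      exact ⟨x, fun _ => hx⟩
    · exact ⟨v 0, fun h => absurd h hk⟩
  choose x hx using this
  -- Each back index `k ≠ 0` yields an end outside `outer m e v 0`: a free vertex of `e k` if `k` is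
  -- fresh, the link `v (k - 1)` otherwise. With `outer m e v 0` this makes `(r - |back|) + (|back|
  -- - 1) = r - 1` distinct ends.
  set g : ℕ → α := fun k => if Fresh m e v k then x k else v (k - 1) with hg
  have hxl : ∀ k ∈ back m e v, x k ∉ link m v := fun k hk => (mem_sdiff.1 (hx k hk)).2
  have hvl : ∀ k ∈ back m e v, v (k - 1) ∈ link m v := fun k hk =>
    mem_link (by have := (mem_back.1 hk).1; omega)
  have hginj : Set.InjOn g ((back m e v).erase 0) := by
    intro i hi j hj hij
    obtain ⟨hi0, hi⟩ := mem_erase.1 hi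
    obtain ⟨hj0, hj⟩ := mem_erase.1 hj
    simp only [hg] at hij
    split_ifs at hij with h1 h2 h2
    · rcases lt_trichotomy i j with hlt | heq | hlt
      · exact absurd (hij ▸ hx j hj) (disjoint_left.1 (h2 i hi hlt) (hx i hi))
      · exact heq
      · exact absurd (hij ▸ hx i hi) (disjoint_left.1 (h1 j hj hlt) (hx j hj))
    · exact absurd (hij ▸ hvl j hj) (hxl i hi)
    · exact absurd (hij ▸ hvl i hi) (hxl j hj)
    · have := (mem_back.1 hi).1
      have := (mem_back.1 hj).1
      have := h.1.vinj _ (by omega) _ (by omega) hij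
      omega
  have hgS : ((back m e v).erase 0).image g ⊆ ends E m r F \ outer m e v 0 := by
    intro y hy
    obtain ⟨k, hk, rfl⟩ := mem_image.1 hy
    obtain ⟨hk0, hk⟩ := mem_erase.1 hk
    simp only [hg]
    split_ifs with h1
    · refine mem_sdiff.2 ⟨outer_mem_ends hs h hk (hx k hk), fun hmem => ?_⟩
      exact disjoint_left.1 (h1 0 h0 (Nat.pos_of_ne_zero hk0)) hmem (hx k hk)
    · refine mem_sdiff.2 ⟨?_, fun hmem => (mem_sdiff.1 hmem).2 (hvl k hk)⟩
      have := (mem_back.1 hk).1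
      obtain ⟨k, rfl⟩ := Nat.exists_eq_succ_of_ne_zero hk0
      exact mem_ends_of_not_fresh hs h (by omega) h1
  have hsub : outer m e v 0 ⊆ ends E m r F := fun y hy => hs.mem_ends h hy
  -- The bound on the number of ends leaves no others; all three claims are read off from this
  -- equality.
  have heq : ((back m e v).erase 0).image g = ends E m r F \ outer m e v 0 := by
    refine eq_of_subset_of_card_le hgS ?_
    rw [card_image_of_injOn hginj, card_erase_of_mem h0, card_sdiff_of_subset hsub]
    have := card_outer_zero hs h
    omega
  have key : ∀ y ∈ ends E m r F, y ∉ outer m e v 0 → ∃ k ∈ back m e v, k ≠ 0 ∧ g k = y := by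
    intro y hy hy0
    have : y ∈ ((back m e v).erase 0).image g := heq ▸ mem_sdiff.2 ⟨hy, hy0⟩
    obtain ⟨k, hk, rfl⟩ := mem_image.1 this
    exact ⟨k, (mem_erase.1 hk).2, (mem_erase.1 hk).1, rfl⟩
  refine ⟨?_, ?_, ?_⟩
  · intro k hk hk0 hf
    rw [card_eq_one]
    refine ⟨x k, eq_singleton_iff_unique_mem.2 ⟨hx k hk, fun y hy => ?_⟩⟩
    obtain ⟨j, hj, hj0, hjy⟩ := key y (outer_mem_ends hs h hk hy) fun hy' =>
      disjoint_left.1 (hf 0 h0 (Nat.pos_of_ne_zero hk0)) hy' hy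
    simp only [hg] at hjy
    split_ifs at hjy with h1
    · rcases lt_trichotomy j k with hlt | rfl | hlt
      · exact absurd hy (disjoint_left.1 (hf j hj hlt) (hjy ▸ hx j hj))
      · exact hjy.symm
      · exact absurd (hjy ▸ hx j hj) (disjoint_left.1 (h1 k hk hlt) hy)
    · exact absurd (hjy ▸ hvl j hj) (mem_sdiff.1 hy).2
  · intro p hp hpS
    obtain ⟨j, hj, hj0, hjy⟩ := key (v p) hpS fun hy' => (mem_sdiff.1 hy').2 (mem_link hp)
    simp only [hg] at hjy
    split_ifs at hjy with h1
    · exact absurd (hjy ▸ mem_link hp) (hxl j hj)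
    · have h2 := (mem_back.1 hj).1
      have := h.1.vinj _ (by omega) _ hp hjy
      obtain rfl : j = p + 1 := by omega
      exact ⟨hj, h1⟩
  · intro y hy hyl
    by_cases hy0 : y ∈ outer m e v 0
    · exact Or.inl hy0
    obtain ⟨j, hj, hj0, hjy⟩ := key y hy hy0
    simp only [hg] at hjy
    split_ifs at hjy with h1
    · exact Or.inr ⟨j, hj, hj0, h1, hjy ▸ hx j hj⟩
    · exact absurd (hjy ▸ hvl j hj) hyl

end Ends

/-! ### The two tight configurations: a pendant hyperedge or a star front -/

section FewEnds

open Finset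

variable {α : Type*} [DecidableEq α] {E F : Finset (Finset α)} {m r : ℕ}
  {e : ℕ → Finset α} {v : ℕ → α}

theorem eq_range_card_of_pred_mem {I : Finset ℕ} (h0 : I.Nonempty → 0 ∈ I)
    (h : ∀ k, 1 ≤ k → k + 1 ∈ I → k ∈ I) : I = range I.card := by
  have hd : ∀ k, k ∈ I → ∀ j ≤ k, j ∈ I := by
    intro k
    induction k with
    | zero => intro hk j hj; rwa [Nat.le_zero.1 hj]
    | succ k ih =>
      intro hk j hj
      rcases Nat.lt_or_ge j (k + 1) with hlt | hge
      · refine ih ?_ j (by omega)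
        rcases Nat.eq_zero_or_pos k with rfl | hk0
        · exact h0 ⟨_, hk⟩
        · exact h k hk0 hk
      · rwa [show j = k + 1 by omega]
  refine eq_of_subset_of_card_le (fun i hi => ?_) (by simp)
  have : range (i + 1) ⊆ I := fun j hj => hd i hi j (by simpa [Nat.lt_succ_iff] using hj)
  have := card_le_card this
  simp only [card_range] at this
  exact mem_range.2 (by omega)

theorem card_outer_of_mem_back (hs : LongestLength E m r) (h : InClass E m r F e v) {k : ℕ}
    (hk : k ∈ back m e v) : (outer m e v k).card +
      (back m (fun j => if j ≤ k then e (k - j) else e j)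
      (fun j => if j < k then v (k - 1 - j) else v j)).card = r := by
  have := card_outer_zero hs (h.rotate hs.free hk)
  rwa [outer_rotate hk] at this

/-- If there are few ends and no path of the class has all possible back links, then the first
hyperedge is pendant. -/
theorem pendant_of_card_back_lt (hs : LongestLength E m r) (h : InClass E m r F e v)
    (hS : (ends E m r F).card ≤ r - 1)
    (hb : ∀ e v, InClass E m r F e v → (back m e v).card < r - 1) :
    (outer m e v 0).card = r - 1 ∧ ∀ x ∈ outer m e v 0, ∀ g ∈ E, x ∈ g → g = e 0 := by
  have hm := hs.two_le
  -- After a rotation the first hyperedge still has at least two free vertices, so tightness forbids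
  -- fresh back indices other than `0`.
  have h1 : ∀ e v, InClass E m r F e v → ∀ y ∈ ends E m r F, y ∉ link m v →
      y ∈ outer m e v 0 := by
    intro e v h y hy hyl
    obtain ⟨s1, s2, s3⟩ := ends_structure hs h hS
    rcases s3 y hy hyl with h0 | ⟨k, hk, hk0, hf, -⟩
    · exact h0
    · have c1 := s1 k hk hk0 hf
      have c2 := card_outer_of_mem_back hs h hk
      have c3 := hb _ _ (h.rotate hs.free hk)
      omega
  have h2 : ∀ e v, InClass E m r F e v → ∀ k ∈ back m e v,
      outer m e v k = outer m e v 0 := by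
    intro e v h k hk
    apply Subset.antisymm
    · intro y hy
      exact h1 e v h y (outer_mem_ends hs h hk hy) (mem_sdiff.1 hy).2
    · intro y hy
      rw [← outer_rotate hk]
      refine h1 _ _ (h.rotate hs.free hk) y (hs.mem_ends h hy) ?_
      rw [link_rotate (mem_back.1 hk).1]
      exact (mem_sdiff.1 hy).2
  have h3 : ∀ e v, InClass E m r F e v → back m e v = range (back m e v).card := by
    intro e v h
    refine eq_range_card_of_pred_mem (fun _ => zero_mem_back hs h) ?_
    intro k hk0 hk
    have c1 := card_outer_zero hs h
    have c2 := hb _ _ h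
    -- Two free vertices are needed: the exchange at `x` brings `e k` to the front and leaves `x'`
    -- free, so `h1` places `x'` in `e k`. Then `x'` shows that the link before `e k` is an end,
    -- which makes `k` a back index.
    obtain ⟨x, hx, x', hx', hne⟩ := one_lt_card.1 (show 1 < (outer m e v 0).card by omega)
    have hkm := (mem_back.1 hk).1
    have hsw := h.swap hs.free (k := k) (by omega) (off_iff.2 (mem_sdiff.1 hx).2)
      (mem_sdiff.1 hx).1 (mem_sdiff.1 (h2 e v h _ hk ▸ hx)).1
    have hmem := h1 _ _ hsw x' (hs.mem_ends h hx') (by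
      rw [← off_iff]
      intro j hj
      have := off_iff.2 (mem_sdiff.1 hx').2
      have a1 := this (k - 1 - j)
      have a2 := this j
      grind)
    have hxk : x' ∈ outer m e v k :=
      mem_sdiff.2 ⟨by simpa using (mem_sdiff.1 hmem).1, (mem_sdiff.1 hx').2⟩
    obtain ⟨k, rfl⟩ := Nat.exists_eq_succ_of_ne_zero (Nat.pos_iff_ne_zero.1 hk0)
    exact ((ends_structure hs h hS).2.1 k (by omega) (mem_ends_of_not_disjoint hs h
      (zero_mem_back hs h) (Nat.succ_pos k) (by omega) hx' hxk)).1
  -- Otherwise `1` is a back index, and the rotation there interchanges `e 0` and `e 1` without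
  -- moving a link. Both hyperedges have the same free vertices and the same linking vertices, hence
  -- are equal.
  have h4 : (back m e v).card = 1 := by
    have c0 := card_pos.2 ⟨_, zero_mem_back hs h⟩
    by_contra hne
    have hb1 : 1 ∈ back m e v := by
      rw [h3 e v h]
      exact mem_range.2 (by omega)
    have h1m := (mem_back.1 hb1).1
    have hr := h.rotate hs.free hb1
    have c1 := card_outer_zero hs h
    have c2 := card_outer_of_mem_back hs h hb1
    have c3 := h3 _ _ hr
    rw [h2 e v h 1 hb1] at c2
    have c4 := (h3 e v h).trans ((congrArg range (by omega)).trans c3.symm)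
    have hsub : e 0 ⊆ e 1 := by
      intro y hy
      by_cases hyl : y ∈ link m v
      · obtain ⟨i, hi, rfl⟩ := mem_image.1 hyl
        have hi' : i ∈ back m e v := mem_back.2 ⟨by have := mem_range.1 hi; omega, hy⟩
        rw [c4] at hi'
        have := (mem_back.1 hi').2
        rcases i with _ | i <;> simpa using this
      · have : y ∈ outer m e v 1 := by
          rw [h2 e v h 1 hb1]
          exact mem_sdiff.2 ⟨hy, hyl⟩
        exact (mem_sdiff.1 this).1
    have he0 := h.1.mem 0 (by omega)
    have he1 := h.1.mem 1 (by omega)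
    have := eq_of_subset_of_card_le hsub (by rw [hs.unif _ he0, hs.unif _ he1])
    have := h.1.einj 0 (by omega) 1 (by omega) this
    omega
  have c1 := card_outer_zero hs h
  refine ⟨by omega, fun x hx g hg hxg => ?_⟩
  have hgF := hs.mem_front (hs.mem_ends h hx) hg hxg
  rw [← h.2] at hgF
  obtain ⟨k, hk, rfl⟩ := mem_image.1 hgF
  have hk := mem_range.1 hk
  rcases k with _ | k
  · rfl
  -- A second path hyperedge `e (k + 1)` through `x` would make `v k` an end and `k + 1` a back
  -- index, but `0` is the only one.
  · have := ((ends_structure hs h hS).2.1 k (by omega) (mem_ends_of_not_disjoint hs h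
      (zero_mem_back hs h) (Nat.succ_pos k) (by omega) hx
      (mem_sdiff.2 ⟨hxg, (mem_sdiff.1 hx).2⟩))).1
    rw [h3 e v h, h4] at this
    simp at this

/-- A path whose first `r - 1` hyperedges consist of the first `r - 1` linking vertices and a
private vertex each. -/
structure StarFront (E : Finset (Finset α)) (m r : ℕ) (e : ℕ → Finset α) (v : ℕ → α) : Prop where
  path : IsPath E m e v
  le : r ≤ m
  leaf : ∀ k < r - 1, ∃ x, e k = insert x ((range (r - 1)).image v) ∧ ∀ g ∈ E, x ∈ g → g = e k

/-- With all `r - 1` back links, `e 0` is the core plus one free vertex. A fresh hyperedge of the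
front also has just one free vertex, so after its rotation all back links are present again and it
contains the core. What remains is the freshness of the whole front. -/
theorem starFront_of_card_back (hs : LongestLength E m r) (h : InClass E m r F e v)
    (hS : (ends E m r F).card ≤ r - 1) (hb : (back m e v).card = r - 1) :
    StarFront E m r e v := by
  have hr := hs.two_lt
  have hbr : ∀ e v, InClass E m r F e v → (back m e v).card = r - 1 →
      back m e v = range (r - 1) := fun e v h hb =>
    eq_of_subset_of_card_le (back_subset hs h) (by simp [hb])
  have hI := hbr e v h hb
  have hm : r ≤ m := by
    have : r - 2 ∈ back m e v := by rw [hI]; exact mem_range.2 (by omega)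
    have := (mem_back.1 this).1
    omega
  have hKl : (range (r - 1)).image v ⊆ link m v :=
    image_subset_image (range_subset_range.2 (by omega))
  have hKc : ((range (r - 1)).image v).card = r - 1 := by
    rw [card_image_of_injOn, card_range]
    intro i hi j hj hij
    have hi := mem_range.1 hi
    have hj := mem_range.1 hj
    exact h.1.vinj i (by omega) j (by omega) hij
  have hins : ∀ i < r - 1, ∀ x, outer m e v i = {x} →
      e i = insert x ((range (r - 1)).image v) := by
    intro i hi x hx
    have hib : i ∈ back m e v := by rw [hI]; exact mem_range.2 hi
    have hxi : x ∈ outer m e v i := by simp [hx]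
    have c1 := card_outer_of_mem_back hs h hib
    rw [hx, card_singleton] at c1
    have c2 := hbr _ _ (h.rotate hs.free hib) (by omega)
    symm
    apply eq_of_subset_of_card_le
    · intro y hy
      rcases mem_insert.1 hy with rfl | hy
      · exact (mem_sdiff.1 hxi).1
      · obtain ⟨j, hj, rfl⟩ := mem_image.1 hy
        have hj := mem_range.1 hj
        have hj' : (if j < i then i - 1 - j else j) ∈ range (r - 1) :=
          mem_range.2 (by split_ifs <;> omega)
        rw [← c2] at hj'
        have := (mem_back.1 hj').2
        simp only [Nat.zero_le, if_true, Nat.sub_zero] at this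
        split_ifs at this with h1 h1
        · rwa [show i - 1 - (i - 1 - j) = j by omega] at this
        · omega
        · exact this
    · rw [card_insert_of_notMem (fun hxK => (mem_sdiff.1 hxi).2 (hKl hxK)), hKc,
        hs.unif _ (h.1.mem i (by omega))]
      omega
  obtain ⟨s1, s2, s3⟩ := ends_structure hs h hS
  have hone : ∀ k < r - 1, Fresh m e v k → (outer m e v k).card = 1 := by
    intro k hk hf
    rcases Nat.eq_zero_or_pos k with rfl | hk0
    · have := card_outer_zero hs h
      omega
    · exact s1 k (by rw [hI]; exact mem_range.2 hk) (by omega) hf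
  have hfresh : ∀ k, k < r - 1 → Fresh m e v k := by
    intro k
    induction k using Nat.strong_induction_on with
    | _ k ih =>
    intro hk
    by_contra hnf
    have hlt : ∀ i < k, ∃ x, e i = insert x ((range (r - 1)).image v) := by
      intro i hi
      obtain ⟨x, hx⟩ := card_eq_one.1 (hone i (by omega) (ih i hi (by omega)))
      exact ⟨x, hins i (by omega) x hx⟩
    have hcore : ∀ i < k, ∀ j < r - 1, v j ∈ e i := by
      intro i hi j hj
      obtain ⟨x, hx⟩ := hlt i hi
      rw [hx]
      exact mem_insert_of_mem (mem_image_of_mem v (mem_range.2 hj))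
    have hnf' := hnf
    simp only [Fresh, not_forall] at hnf'
    obtain ⟨i, hi, hik, hd⟩ := hnf'
    obtain ⟨x, hxi, hxk⟩ := not_disjoint_iff.1 hd
    have hkb : k ∈ back m e v := by rw [hI]; exact mem_range.2 hk
    rcases Nat.lt_or_ge k 2 with hk2 | hk2
    -- If `1` is not fresh, `e 1` has the same free vertex as `e 0`, and both consist of it and the
    -- core.
    · obtain rfl : k = 1 := by omega
      obtain ⟨x, hx⟩ := card_eq_one.1 (hone 0 (by omega) (ih 0 (by omega) (by omega)))
      have hsub : outer m e v 1 ⊆ outer m e v 0 := by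
        intro y hy
        rcases s3 y (outer_mem_ends hs h hkb hy) (mem_sdiff.1 hy).2 with h0 | ⟨j, hj, hj0, hf, hyj⟩
        · exact h0
        · have : j ≠ 1 := fun hj1 => hnf (hj1 ▸ hf)
          exact absurd hyj (disjoint_left.1 (hf 1 hkb (by omega)) hy)
      have hx1 : outer m e v 1 = {x} := by
        rw [hx] at hsub
        exact (subset_singleton_iff.1 hsub).resolve_left (outer_nonempty hs h hkb).ne_empty
      have := (hins 0 (by omega) x hx).trans (hins 1 (by omega) x hx1).symm
      have := h.1.einj 0 (by omega) 1 (by omega) this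
      omega
    -- From here the critical index is `k + 2`. The exchange at `x` frees `v (k + 1)`, a core vertex
    -- contained in all earlier hyperedges, in particular in the first two of the new path. Hence
    -- the first link of the new path is an end; it is some `v p` with `p ≤ k`, and `p + 1` is fresh
    -- by induction.
    · obtain ⟨k, rfl⟩ := Nat.exists_eq_add_of_le' hk2
      have h' := h.rotate hs.free hi
      have hoff : Off m (fun j => if j < i then v (i - 1 - j) else v j) x := by
        rw [off_iff, link_rotate (mem_back.1 hi).1]
        exact (mem_sdiff.1 hxi).2
      have h2 := h'.swap hs.free (k := k + 1) (by omega) hoff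
        (by simpa using (mem_sdiff.1 hxi).1)
        (by simpa [show ¬ k + 1 + 1 ≤ i by omega] using (mem_sdiff.1 hxk).1)
      have hoff2 := off_swap h'.1 (show k + 1 + 1 < m by omega) hoff
      simp only [show ¬ k + 1 < i by omega, if_false] at hoff2
      have hmem := mem_ends_of_not_disjoint hs h2 (i := 0) (k := 0) (x := v (k + 1))
        (zero_mem_back hs h2) (by omega) (by omega)
        (mem_sdiff.2 ⟨by
          have a1 := hcore (i - (k + 1)) (by omega) (k + 1) (by omega)
          have a2 := hcore (k + 1) (by omega) (k + 1) (by omega)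
          grind, off_iff.1 hoff2⟩)
        (mem_sdiff.2 ⟨by
          have a1 := hcore (i - k) (by omega) (k + 1) (by omega)
          have a2 := hcore k (by omega) (k + 1) (by omega)
          grind, off_iff.1 hoff2⟩)
      have hp : ∃ p < k + 1, v p ∈ ends E m r F := by
        by_cases hki : k < i
        · exact ⟨i - 1 - k, by omega, by simpa [hki] using hmem⟩
        · exact ⟨k, by omega, by simpa [hki] using hmem⟩
      obtain ⟨p, hp, hpS⟩ := hp
      exact (s2 p (by omega) hpS).2 (ih (p + 1) (by omega) (by omega))
  refine ⟨h.1, hm, fun k hk => ?_⟩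
  have hkb : k ∈ back m e v := by rw [hI]; exact mem_range.2 hk
  obtain ⟨x, hx⟩ := card_eq_one.1 (hone k hk (hfresh k hk))
  have hxk : x ∈ outer m e v k := by simp [hx]
  refine ⟨x, hins k hk x hx, fun g hg hxg => ?_⟩
  have hgF := hs.mem_front (outer_mem_ends hs h hkb hxk) hg hxg
  rw [← h.2] at hgF
  obtain ⟨j, hj, rfl⟩ := mem_image.1 hgF
  have hj : j < r - 1 := by have := mem_range.1 hj; omega
  have hjb : j ∈ back m e v := by rw [hI]; exact mem_range.2 hj
  have hxj : x ∈ outer m e v j := mem_sdiff.2 ⟨hxg, (mem_sdiff.1 hxk).2⟩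
  rcases lt_trichotomy j k with hlt | rfl | hlt
  · exact absurd hxk (disjoint_left.1 (hfresh k hk j hjb hlt) hxj)
  · rfl
  · exact absurd hxj (disjoint_left.1 (hfresh j hj k hkb hlt) hxk)

end FewEnds

/-! ### Sparse sets and star sets -/

section Sparse

open Finset

variable {α : Type*} [DecidableEq α]

/-- The hyperedges that meet a set of vertices. -/
def inc (E : Finset (Finset α)) (S : Finset α) : Finset (Finset α) :=
  E.filter fun e => ¬ Disjoint e S

theorem mem_inc {E : Finset (Finset α)} {S : Finset α} {f : Finset α} :
    f ∈ inc E S ↔ f ∈ E ∧ ∃ x ∈ f, x ∈ S := by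
  simp [inc, not_disjoint_iff]

/-- `r` vertices of `V` meet at most `r - 1` hyperedges. -/
def HasSparseSet (E : Finset (Finset α)) (V : Finset α) (r : ℕ) : Prop :=
  ∃ S ⊆ V, r ≤ S.card ∧ (inc E S).card ≤ r - 1

/-- A proper subset of the vertices meets as few hyperedges as it would in a star; if it misses only
one vertex, all hyperedges share `r - 1` vertices. -/
def HasStarSet (E : Finset (Finset α)) (V : Finset α) (r : ℕ) : Prop :=
  ∃ D ⊂ V, D.Nonempty ∧ (inc E D).card + r ≤ D.card + 2 ∧
    ((V \ D).card = 1 → ∃ K : Finset α, K.card = r - 1 ∧ ∀ f ∈ E, K ⊆ f)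

variable {E F : Finset (Finset α)} {m r : ℕ} {e : ℕ → Finset α} {v : ℕ → α} {V : Finset α}

namespace StarFront

theorem core_card (h : StarFront E m r e v) : ((range (r - 1)).image v).card = r - 1 := by
  have := h.le
  rw [card_image_of_injOn, card_range]
  intro i hi j hj hij
  have hi := mem_range.1 hi
  have hj := mem_range.1 hj
  exact h.path.vinj i (by omega) j (by omega) hij

theorem core_mem (h : StarFront E m r e v) {k j : ℕ} (hk : k < r - 1) (hj : j < r - 1) :
    v j ∈ e k := by
  obtain ⟨x, hx, -⟩ := h.leaf k hk
  rw [hx]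
  exact mem_insert_of_mem (mem_image_of_mem v (mem_range.2 hj))

/-- The core vertices can be reordered with prescribed first and last vertex. -/
theorem reorder (hs : LongestLength E m r) (h : StarFront E m r e v) {i j : ℕ} (hi : i < r - 1)
    (hj : j < r - 1) (hij : j ≠ i) (hv : v i ∈ e (r - 1)) :
    ∃ w : ℕ → α, IsPath E m e w ∧ w 0 = v j ∧ ∀ p < r - 1, ∃ q < r - 1, w p = v q := by
  have hr := hs.two_lt
  have hm := h.le
  -- The first `r - 1` hyperedges contain the whole core, so its order is free except that the last
  -- core vertex must lie in `e (r - 1)`; `i` goes there and `j` to the front.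
  obtain ⟨σ, h0, h1, h2, h3⟩ : ∃ σ : Equiv.Perm ℕ, σ 0 = j ∧ σ (r - 2) = i ∧
      (∀ p, p < r - 1 → σ p < r - 1) ∧ ∀ p, r - 1 ≤ p → σ p = p := by
    refine ⟨Equiv.swap 0 j * Equiv.swap (r - 2) (Equiv.swap 0 j i), ?_, ?_, ?_, ?_⟩
    all_goals
      simp only [Equiv.Perm.mul_apply, Equiv.swap_apply_def]
      grind
  refine ⟨fun p => v (σ p), ⟨h.path.mem, h.path.einj, ?_, ?_, ?_⟩, by simp [h0], ?_⟩
  · intro p hp q hq hpq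
    have hlt : ∀ p, p + 1 < m → σ p + 1 < m := fun p hp => by
      rcases Nat.lt_or_ge p (r - 1) with hlt | hge
      · have := h2 p hlt; omega
      · rw [h3 p hge]; exact hp
    exact σ.injective (h.path.vinj _ (hlt p hp) _ (hlt q hq) hpq)
  · intro p hp
    rcases Nat.lt_or_ge p (r - 1) with hlt | hge
    · exact h.core_mem hlt (h2 p hlt)
    · simpa [h3 p hge] using h.path.left p hp
  · intro p hp
    rcases Nat.lt_trichotomy p (r - 2) with hlt | rfl | hge
    · exact h.core_mem (by omega) (h2 p (by omega))
    · simpa [h1, show r - 2 + 1 = r - 1 by omega] using hv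
    · simpa [h3 p (by omega)] using h.path.right p hp
  · intro p hp
    exact ⟨σ p, h2 p hp, rfl⟩

/-- With `v j` moved to the front, `v j ∈ e l` would close `e 1, …, e l` to a cycle of length `l ≥
r`. -/
theorem not_mem_later (hs : LongestLength E m r) (h : StarFront E m r e v) {i j l : ℕ}
    (hi : i < r - 1) (hj : j < r - 1) (hij : j ≠ i) (hv : v i ∈ e (r - 1)) (hl : r - 1 < l)
    (hlm : l < m) : v j ∉ e l := by
  intro hjl
  have hr := hs.two_lt
  obtain ⟨w, hw, hw0, -⟩ := h.reorder hs hi hj hij hv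
  have := hw.sub_lt hs.free (a := 0) (b := l) (by omega) hlm (by rwa [hw0])
  omega

/-- Hyperedges made up of the core and a private vertex. -/
def IsStarEdge (E : Finset (Finset α)) (K f : Finset α) : Prop :=
  ∃ y, f = insert y K ∧ ∀ g ∈ E, y ∈ g → g = f

/-- Replacing `e 0` by `f`, with `v j` as first link, gives another longest path, so the vertices of
`f` outside the core lie in no other hyperedge. Two of them, with the private vertices of `e 0, …, e
(r - 3)`, would form a sparse set. -/
theorem isStarEdge_of_not_mem_path (hs : LongestLength E m r) (h : StarFront E m r e v)
    (hV : ∀ f ∈ E, f ⊆ V) (hn : ¬ HasSparseSet E V r) {i j : ℕ} (hi : i < r - 1)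
    (hj : j < r - 1) (hij : j ≠ i) (hv : v i ∈ e (r - 1)) {f : Finset α} (hf : f ∈ E)
    (hfe : ∀ l < m, f ≠ e l) (hjf : v j ∈ f) : IsStarEdge E ((range (r - 1)).image v) f := by
  have hr := hs.two_lt
  have hm := h.le
  obtain ⟨w, hw, hw0, hwv⟩ := h.reorder hs hi hj hij hv
  set K := (range (r - 1)).image v with hK
  have hp : IsPath E m (Function.update e 0 f) w := by
    constructor
    · intro k hk
      rcases k with _ | k
      · simpa using hf
      · simpa using h.path.mem _ hk
    · intro k hk l hl hkl
      have a1 := h.path.einj k hk l hl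
      have a2 := hfe k hk
      have a3 := hfe l hl
      simp only [Function.update_apply] at hkl
      grind
    · exact hw.vinj
    · intro k hk
      rcases k with _ | k
      · simpa [hw0] using hjf
      · simpa using hw.left _ hk
    · intro k hk
      simpa using hw.right _ hk
  have : Nonempty α := ⟨v 0⟩
  choose! x hx hx' using h.leaf
  have hY : ∀ y ∈ f \ K, ∀ g ∈ E, y ∈ g → g = f := by
    intro y hy g hg hyg
    obtain ⟨hyf, hyK⟩ := mem_sdiff.1 hy
    have hoff : Off m w y := by
      rintro p hp' rfl
      have := hp.lt_of_mem_first hs.free hp' (by simpa using hyf)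
      obtain ⟨q, hq, hpq⟩ := hwv p (by omega)
      exact hyK (hpq ▸ mem_image_of_mem v (mem_range.2 hq))
    by_cases hge : ∀ k < m, g ≠ Function.update e 0 f k
    · exact absurd (hp.cons hg hge hoff (by simpa using hyf) hyg) (hs.max _ _)
    · push Not at hge
      obtain ⟨k, hk, rfl⟩ := hge
      rcases k with _ | k
      · simp
      -- A front hyperedge `e (k + 1)` contains `y` only as its private vertex, which would force `f
      -- = e (k + 1)`.
      · exfalso
        have hk' := hp.lt_of_off hs.free hk hoff (by simpa using hyf) hyg
        simp only [Function.update_apply, Nat.succ_ne_zero, if_false] at hyg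
        rw [hx (k + 1) (by omega)] at hyg
        rcases mem_insert.1 hyg with rfl | hyg
        · exact hfe (k + 1) hk (hx' (k + 1) (by omega) f hf hyf)
        · exact hyK hyg
  have hc := card_sdiff_add_card_inter f K
  have hKc : K.card = r - 1 := h.core_card
  have hcK : (f ∩ K).card ≤ r - 1 := hKc ▸ card_le_card inter_subset_right
  rw [hs.unif f hf] at hc
  have hY1 : (f \ K).card = 1 := by
    by_contra hne
    apply hn
    have hxinj : Set.InjOn x (range (r - 2)) := by
      intro k hk l hl hkl
      have hk := mem_range.1 hk
      have hl := mem_range.1 hl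
      have hkE := h.path.mem k (by omega)
      have : x l ∈ e k := by rw [← hkl, hx k (by omega)]; exact mem_insert_self _ _
      exact h.path.einj k (by omega) l (by omega) (hx' l (by omega) _ hkE this)
    have hxe : ∀ k < r - 1, x k ∈ e k := fun k hk => by
      rw [hx k hk]; exact mem_insert_self _ _
    refine ⟨(f \ K) ∪ (range (r - 2)).image x, ?_, ?_, ?_⟩
    · intro y hy
      rcases mem_union.1 hy with hy | hy
      · exact hV f hf (mem_sdiff.1 hy).1
      · obtain ⟨k, hk, rfl⟩ := mem_image.1 hy
        have hk := mem_range.1 hk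
        exact hV _ (h.path.mem k (by omega)) (hxe k (by omega))
    · rw [card_union_of_disjoint, card_image_of_injOn hxinj, card_range]
      · omega
      · rw [disjoint_left]
        intro y hy hy'
        obtain ⟨k, hk, rfl⟩ := mem_image.1 hy'
        have hk := mem_range.1 hk
        exact hfe k (by omega) (hx' k (by omega) f hf (mem_sdiff.1 hy).1)
    · have hsub : inc E ((f \ K) ∪ (range (r - 2)).image x) ⊆
          insert f ((range (r - 2)).image e) := by
        intro g hg
        obtain ⟨hg, y, hyg, hy⟩ := mem_inc.1 hg
        rcases mem_union.1 hy with hy | hy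
        · rw [hY y hy g hg hyg]
          exact mem_insert_self _ _
        · obtain ⟨k, hk, rfl⟩ := mem_image.1 hy
          refine mem_insert_of_mem (mem_image.2 ⟨k, hk, ?_⟩)
          have hk := mem_range.1 hk
          exact (hx' k (by omega) g hg hyg).symm
      have h1 := card_le_card hsub
      have h2 := card_insert_le f ((range (r - 2)).image e)
      have h3 := card_image_le (s := range (r - 2)) (f := e)
      rw [card_range] at h3
      omega
  obtain ⟨y, hy⟩ := card_eq_one.1 hY1
  have hyY : y ∈ f \ K := by simp [hy]
  refine ⟨y, ?_, hY y hyY⟩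
  have : f ∩ K = K := eq_of_subset_of_card_le inter_subset_right (by omega)
  rw [← sdiff_union_inter f K, hy, this]
  rfl

/-- Let `T` be the set of star hyperedges. The core and the private vertices of `T` are `r - 1 +
|T|` vertices, and a hyperedge through a core vertex other than `v (r - 2)` is in `T` or is `e (r -
1)`. The set `D` consists of all these vertices or of all but `v (r - 2)`. -/
theorem hasStarSet (hs : LongestLength E m r) (h : StarFront E m r e v)
    (hV : ∀ f ∈ E, f ⊆ V) (hn : ¬ HasSparseSet E V r) : HasStarSet E V r := by
  classical
  have hr := hs.two_lt
  have hm := h.le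
  have hnp := fun {i j} => h.isStarEdge_of_not_mem_path hs hV hn (i := i) (j := j)
  have hKc := h.core_card
  have hKv : ∀ j < r - 1, v j ∈ (range (r - 1)).image v := fun j hj =>
    mem_image_of_mem v (mem_range.2 hj)
  have hlast : v (r - 2) ∈ e (r - 1) := by
    have := h.path.right (r - 2) (by omega)
    rwa [show r - 2 + 1 = r - 1 by omega] at this
  have hfront : ∀ l < r - 1, IsStarEdge E ((range (r - 1)).image v) (e l) := h.leaf
  have hKV : (range (r - 1)).image v ⊆ V := by
    intro y hy
    obtain ⟨j, hj, rfl⟩ := mem_image.1 hy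
    exact hV _ (h.path.mem 0 (by omega)) (h.core_mem (by omega) (mem_range.1 hj))
  set K := (range (r - 1)).image v with hK
  have hlater : ∀ i < r - 1, v i ∈ e (r - 1) → ∀ j < r - 1, j ≠ i → ∀ f ∈ E, v j ∈ f →
      IsStarEdge E K f ∨ f = e (r - 1) := by
    intro i hi hv j hj hij f hf hjf
    by_cases hfe : ∀ l < m, f ≠ e l
    · exact Or.inl (hnp hi hj hij hv hf hfe hjf)
    · push Not at hfe
      obtain ⟨l, hl, rfl⟩ := hfe
      rcases Nat.lt_trichotomy l (r - 1) with hlt | rfl | hlt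
      · exact Or.inl (hfront l hlt)
      · exact Or.inr rfl
      · exact absurd hjf (h.not_mem_later hs hi hj hij hv hlt hl)
  have : ∀ f, ∃ y, IsStarEdge E K f → f = insert y K ∧ ∀ g ∈ E, y ∈ g → g = f := fun f => by
    by_cases hf : IsStarEdge E K f
    · obtain ⟨y, hy⟩ := hf
      exact ⟨y, fun _ => hy⟩
    · exact ⟨v 0, fun h => absurd h hf⟩
  choose y hy using this
  set T := E.filter (IsStarEdge E K) with hT
  have hTy : ∀ f ∈ T, f ∈ E ∧ f = insert (y f) K ∧ ∀ g ∈ E, y f ∈ g → g = f := fun f hf =>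
    ⟨(mem_filter.1 hf).1, hy f (mem_filter.1 hf).2⟩
  have hyf : ∀ f ∈ T, y f ∈ f := fun f hf => by
    exact (Finset.ext_iff.1 (hTy f hf).2.1 _).2 (mem_insert_self _ _)
  have hyK : ∀ f ∈ T, y f ∉ K := fun f hf hfK => by
    obtain ⟨h1, h2, -⟩ := hTy f hf
    rw [insert_eq_of_mem hfK] at h2
    have := hs.unif f h1
    rw [h2, hKc] at this
    omega
  have hyinj : Set.InjOn y T := by
    intro f hf g hg hfg
    exact (hTy g hg).2.2 f (hTy f hf).1 (hfg ▸ hyf f hf)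
  have hDc : (K ∪ T.image y).card = r - 1 + T.card := by
    rw [card_union_of_disjoint, hKc, card_image_of_injOn hyinj]
    rw [disjoint_left]
    intro x hx hx'
    obtain ⟨f, hf, rfl⟩ := mem_image.1 hx'
    exact hyK f hf hx
  have hDV : K ∪ T.image y ⊆ V := by
    refine union_subset hKV fun x hx => ?_
    obtain ⟨f, hf, rfl⟩ := mem_image.1 hx
    exact hV f (hTy f hf).1 (hyf f hf)
  -- A hyperedge has more than one vertex, so it cannot avoid a set that misses one vertex.
  have hsmall : ∀ D ⊆ V, (V \ D).card = 1 → ∀ f ∈ E, f ∈ inc E D := by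
    intro D _ hD f hf
    rw [mem_inc]
    refine ⟨hf, ?_⟩
    by_contra hno
    push Not at hno
    have : f ⊆ V \ D := fun x hx => mem_sdiff.2 ⟨hV f hf hx, hno x hx⟩
    have := card_le_card this
    rw [hs.unif f hf] at this
    omega
  have hKT : ∀ f ∈ T, K ⊆ f := fun f hf => by
    have h2 := (hTy f hf).2.1
    rw [h2]
    exact subset_insert _ _
  have hv2 : v (r - 2) ∈ K := hKv _ (by omega)
  -- With two core vertices in `e (r - 1)`, every core vertex can be moved to the front past one of
  -- them. The full set then meets only `T` and `e (r - 1)`: one vertex and at most one hyperedge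
  -- more than in the other case.
  by_cases hA : (∃ i < r - 2, v i ∈ e (r - 1)) ∧ ¬ IsStarEdge E K (e (r - 1))
  · obtain ⟨⟨i, hi, hiv⟩, hns⟩ := hA
    have heE := h.path.mem (r - 1) (by omega)
    have hinc : inc E (K ∪ T.image y) ⊆ insert (e (r - 1)) T := by
      intro f hf
      obtain ⟨hf, x, hxf, hx⟩ := mem_inc.1 hf
      rcases mem_union.1 hx with hx | hx
      · obtain ⟨j, hj, rfl⟩ := mem_image.1 hx
        have hj := mem_range.1 hj
        have : IsStarEdge E K f ∨ f = e (r - 1) := by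
          by_cases hji : j = i
          · exact hlater (r - 2) (by omega) hlast j hj (by omega) f hf hxf
          · exact hlater i (by omega) hiv j hj hji f hf hxf
        rcases this with h1 | rfl
        · exact mem_insert_of_mem (mem_filter.2 ⟨hf, h1⟩)
        · exact mem_insert_self _ _
      · obtain ⟨g, hg, rfl⟩ := mem_image.1 hx
        rw [(hTy g hg).2.2 f hf hxf]
        exact mem_insert_of_mem hg
    have hel : ∀ x ∈ e (r - 1), x ∈ K ∪ T.image y → x ∈ K := by
      intro x hx hx'
      rcases mem_union.1 hx' with hx' | hx'
      · exact hx'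
      · obtain ⟨g, hg, rfl⟩ := mem_image.1 hx'
        have := (hTy g hg).2.2 _ heE hx
        exact absurd (this ▸ (mem_filter.1 hg).2) hns
    refine ⟨K ∪ T.image y, ⟨hDV, fun hsub => ?_⟩, ⟨_, mem_union_left _ hv2⟩, ?_, ?_⟩
    · have h1 : e (r - 1) ⊆ K := fun x hx => hel x hx (hsub (hV _ heE hx))
      have := card_le_card h1
      rw [hs.unif _ heE] at this
      omega
    · have h1 := card_le_card hinc
      have h2 := card_insert_le (e (r - 1)) T
      omega
    · intro h1
      refine ⟨K, hKc, fun f hf => ?_⟩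
      rcases mem_insert.1 (hinc (hsmall _ hDV h1 f hf)) with rfl | hf
      · have hsub : e (r - 1) ⊆ K ∪ (V \ (K ∪ T.image y)) := by
          intro x hx
          by_cases hxD : x ∈ K ∪ T.image y
          · exact mem_union_left _ (hel x hx hxD)
          · exact mem_union_right _ (mem_sdiff.2 ⟨hV _ heE hx, hxD⟩)
        have h3 := card_union_le K (V \ (K ∪ T.image y))
        have := eq_of_subset_of_card_le hsub (by rw [hs.unif _ heE]; omega)
        rw [this]
        exact subset_union_left
      · exact hKT f hf
  -- Only `v (r - 2)` can now lie in hyperedges outside `T`, so it is left out.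
  · have hinc : inc E ((K ∪ T.image y).erase (v (r - 2))) ⊆ T := by
      intro f hf
      obtain ⟨hf, x, hxf, hx⟩ := mem_inc.1 hf
      obtain ⟨hne, hx⟩ := mem_erase.1 hx
      rcases mem_union.1 hx with hx | hx
      · obtain ⟨j, hj, rfl⟩ := mem_image.1 hx
        have hj := mem_range.1 hj
        have hj2 : j ≠ r - 2 := fun hj2 => hne (hj2 ▸ rfl)
        rcases hlater (r - 2) (by omega) hlast j hj hj2 f hf hxf with h1 | rfl
        · exact mem_filter.2 ⟨hf, h1⟩
        · refine mem_filter.2 ⟨hf, ?_⟩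
          by_contra hns
          exact hA ⟨⟨j, by omega, hxf⟩, hns⟩
      · obtain ⟨g, hg, rfl⟩ := mem_image.1 hx
        rw [(hTy g hg).2.2 f hf hxf]
        exact hg
    have hc := card_erase_of_mem (mem_union_left (T.image y) hv2)
    have hDV' : (K ∪ T.image y).erase (v (r - 2)) ⊆ V := (erase_subset _ _).trans hDV
    refine ⟨(K ∪ T.image y).erase (v (r - 2)), ⟨hDV', fun hsub => ?_⟩, ?_, ?_, ?_⟩
    · exact notMem_erase _ _ (hsub (hKV hv2))
    · rw [← card_pos]
      omega
    · have h1 := card_le_card hinc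
      omega
    · intro h1
      exact ⟨K, hKc, fun f hf => hKT f (hinc (hsmall _ hDV' h1 f hf))⟩

end StarFront

/-- The first hyperedge of a longest path is pendant, or the hypergraph has a sparse part. -/
theorem pendant_or_sparse (hs : LongestLength E m r) (hV : ∀ f ∈ E, f ⊆ V) (h : IsPath E m e v) :
    HasSparseSet E V r ∨ HasStarSet E V r ∨
      ∃ Y ⊆ e 0, Y.card = r - 1 ∧ ∀ x ∈ Y, ∀ g ∈ E, x ∈ g → g = e 0 := by
  classical
  by_cases hn : HasSparseSet E V r
  · exact Or.inl hn
  right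
  have hc : InClass E m r ((range (min m (r - 1))).image e) e v := ⟨h, rfl⟩
  set F := (range (min m (r - 1))).image e
  -- Ends meet only the at most `r - 1` hyperedges of `F`, so `r` of them would be sparse.
  have hS : (ends E m r F).card ≤ r - 1 := by
    by_contra hlt
    refine hn ⟨ends E m r F, fun x hx => ?_, by omega, ?_⟩
    · obtain ⟨f, hf, hx⟩ := mem_biUnion.1 (mem_filter.1 hx).1
      exact hV f hf hx
    · refine (card_le_card fun g hg => ?_).trans hc.card_le
      obtain ⟨hg, x, hxg, hx⟩ := mem_inc.1 hg
      exact hs.mem_front hx hg hxg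
  -- The ends depend only on `F`, so a star front on any path of the class serves.
  by_cases hb : ∃ e v, InClass E m r F e v ∧ (back m e v).card = r - 1
  · obtain ⟨e', v', h', hb⟩ := hb
    exact Or.inl ((starFront_of_card_back hs h' hS hb).hasStarSet hs hV hn)
  · push Not at hb
    obtain ⟨h1, h2⟩ := pendant_of_card_back_lt hs hc hS fun e v h =>
      lt_of_le_of_ne (card_back_le hs h) (hb e v h)
    exact Or.inr ⟨outer m e v 0, sdiff_subset, h1, h2⟩

theorem exists_longest [Nonempty α] (hne : E.Nonempty) : ∃ m, 1 ≤ m ∧ (∃ e v, IsPath E m e v) ∧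
    ∀ e v, ¬ IsPath E (m + 1) e v := by
  by_contra hno
  push Not at hno
  have : ∀ m, ∃ e v, IsPath E (m + 1) e v := by
    intro m
    induction m with
    | zero =>
      obtain ⟨f, hf⟩ := hne
      obtain ⟨a⟩ := ‹Nonempty α›
      exact ⟨fun _ => f, fun _ => a, fun _ _ => hf, by omega, by omega, by omega, by omega⟩
    | succ m ih => exact hno (m + 1) (by omega) ih
  obtain ⟨e, v, h⟩ := this E.card
  have h1 : (range (E.card + 1)).image e ⊆ E := fun f hf => by
    obtain ⟨i, hi, rfl⟩ := mem_image.1 hf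
    exact h.mem i (mem_range.1 hi)
  have h2 := card_le_card h1
  rw [card_image_of_injOn, card_range] at h2
  · omega
  · intro i hi j hj hij
    exact h.einj i (mem_range.1 hi) j (mem_range.1 hj) hij

/-- The structure theorem: `r` vertices meet at most `r - 1` hyperedges, or there is a part that
looks like a star. -/
theorem sparse_or_star (hr : 2 < r) (hu : ∀ f ∈ E, f.card = r) (hE : CycleFree E r)
    (hV : ∀ f ∈ E, f ⊆ V) (hne : E.Nonempty) : HasSparseSet E V r ∨ HasStarSet E V r := by
  have : Nonempty α := by
    obtain ⟨f, hf⟩ := hne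
    obtain ⟨a, -⟩ := card_pos.1 (show 0 < f.card by have := hu f hf; omega)
    exact ⟨a⟩
  obtain ⟨m, hm, ⟨e, v, h⟩, hmax⟩ := exists_longest hne
  rcases Nat.lt_or_ge m 2 with hm2 | hm2
  · obtain rfl : m = 1 := by omega
    have he := h.mem 0 (by omega)
    refine Or.inl ⟨e 0, hV _ he, (hu _ he).ge, ?_⟩
    have : inc E (e 0) ⊆ {e 0} := by
      intro g hg
      obtain ⟨hg, x, hxg, hx⟩ := mem_inc.1 hg
      by_contra hge
      refine hmax _ _ (h.cons hg (fun i hi => ?_) (fun i hi => by omega) hx hxg)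
      obtain rfl : i = 0 := by omega
      simpa using hge
    have := card_le_card this
    rw [card_singleton] at this
    omega
  · have hs : LongestLength E m r := ⟨hr, hm2, hu, hE, hmax⟩
    rcases pendant_or_sparse hs hV h with h1 | h1 | ⟨Y, hY, hYc, hYd⟩
    · exact Or.inl h1
    · exact Or.inr h1
    rcases pendant_or_sparse hs hV h.reverse with h1 | h1 | ⟨Z, hZ, hZc, hZd⟩
    · exact Or.inl h1
    · exact Or.inr h1
    have he := h.mem 0 (by omega)
    have he' := h.mem (m - 1 - 0) (by omega)
    -- Two pendant hyperedges give `2 * (r - 1) ≥ r` vertices that meet only `2 ≤ r - 1` hyperedges.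
    refine Or.inl ⟨Y ∪ Z, union_subset (hY.trans (hV _ he)) (hZ.trans (hV _ he')), ?_, ?_⟩
    · rw [card_union_of_disjoint]
      · omega
      · rw [disjoint_left]
        intro x hx hx'
        have := h.einj _ (by omega) _ (by omega) (hYd x hx _ he' (hZ hx'))
        omega
    · have : inc E (Y ∪ Z) ⊆ {e 0, e (m - 1 - 0)} := by
        intro g hg
        obtain ⟨hg, x, hxg, hx⟩ := mem_inc.1 hg
        rcases mem_union.1 hx with hx | hx
        · simp [hYd x hx g hg hxg]
        · simp [hZd x hx g hg hxg]
      have h1 := card_le_card this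
      have h2 := card_le_two (a := e 0) (b := e (m - 1 - 0))
      omega

end Sparse

/-! ### The upper bound, and equality in the linear term -/

section Bound

open Finset

/-- The maximum number of hyperedges. -/
def bound (r n : ℕ) : ℕ := max ((n - 1) / r * (r - 1)) (n + 1 - r)

theorem bound_le_sub_one {r n : ℕ} (hr : 2 < r) (hn : 1 ≤ n) : bound r n ≤ n - 1 := by
  have h1 : (n - 1) / r * (r - 1) ≤ (n - 1) / r * r := Nat.mul_le_mul_left _ (by omega)
  have h2 := Nat.div_mul_le_self (n - 1) r
  exact max_le (by omega) (by omega)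

/-- This strictness is what reduces the complement of `D` to one vertex in `exists_core_of_card_eq`.
-/
theorem bound_lt_sub_one {r n : ℕ} (hr : 2 < r) (hn : 2 ≤ n) : bound r n < n - 1 := by
  have h2 := Nat.div_mul_le_self (n - 1) r
  refine max_lt ?_ (by omega)
  rcases Nat.eq_zero_or_pos ((n - 1) / r) with h0 | h0
  · rw [h0]; omega
  · exact (Nat.mul_lt_mul_of_pos_left (by omega) h0).trans_le h2

theorem sub_one_div_mul_step {r n : ℕ} (hr : 2 < r) (hn : 1 ≤ n) :
    (n + r - 1) / r * (r - 1) = (n - 1) / r * (r - 1) + (r - 1) := by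
  rw [show n + r - 1 = n - 1 + r by omega, Nat.add_div_right _ (by omega), Nat.succ_mul]

/-- It pays for the removal of a sparse set in the induction. -/
theorem bound_add_le {r n : ℕ} (hr : 2 < r) (hn : 1 ≤ n) :
    bound r n + (r - 1) ≤ bound r (n + r) := by
  have h := sub_one_div_mul_step hr hn
  simp only [bound]
  rw [h]
  omega

variable {α : Type*} {E : Finset (Finset α)} {V : Finset α} {r : ℕ}

theorem CycleFree.mono {E' : Finset (Finset α)} (h : CycleFree E r) (hE : E' ⊆ E) :
    CycleFree E' r :=
  fun t ht e v he => h t ht e v fun i hi => hE (he i hi)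

theorem card_le_one_of_card_eq (hu : ∀ f ∈ E, f.card = r) (hV : ∀ f ∈ E, f ⊆ V)
    (hc : V.card = r) : E ⊆ {V} := by
  intro f hf
  exact mem_singleton.2 (eq_of_subset_of_card_le (hV f hf) (by rw [hc, hu f hf]))

variable [DecidableEq α]

theorem HasSparseSet.exists_card_eq (h : HasSparseSet E V r) :
    ∃ S ⊆ V, S.card = r ∧ (inc E S).card ≤ r - 1 := by
  obtain ⟨S, hS, hc, hi⟩ := h
  obtain ⟨T, hT, hTc⟩ := exists_subset_card_eq hc
  refine ⟨T, hT.trans hS, hTc, (card_le_card fun f hf => ?_).trans hi⟩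
  obtain ⟨hf, x, hx, hxT⟩ := mem_inc.1 hf
  exact mem_inc.2 ⟨hf, x, hx, hT hxT⟩

theorem card_sdiff_inc (S : Finset α) : (E \ inc E S).card + (inc E S).card = E.card :=
  card_sdiff_add_card_eq_card (filter_subset _ _)

theorem subset_sdiff_of_mem (hV : ∀ f ∈ E, f ⊆ V) {S : Finset α} :
    ∀ f ∈ E \ inc E S, f ⊆ V \ S := by
  intro f hf x hx
  obtain ⟨hf, hfi⟩ := mem_sdiff.1 hf
  exact mem_sdiff.2 ⟨hV f hf hx, fun hxS => hfi (mem_inc.2 ⟨hf, x, hx, hxS⟩)⟩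

/-- After the removal of `r` sparse vertices the induction hypothesis is used in full. After the
removal of a star set the coarse bound `bound_le_sub_one` for the rest suffices. -/
theorem card_le_bound (hr : 2 < r) (hu : ∀ f ∈ E, f.card = r) (hE : CycleFree E r)
    (hV : ∀ f ∈ E, f ⊆ V) : E.card ≤ bound r V.card := by
  induction hn : V.card using Nat.strong_induction_on generalizing V E with
  | _ n ih =>
  subst hn
  rcases E.eq_empty_or_nonempty with rfl | hne
  · simp
  have hrest : ∀ S ⊆ V, S.Nonempty → (E \ inc E S).card ≤ bound r (V.card - S.card) := by
    intro S hS hS0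
    have h0 := card_pos.2 hS0
    have h1 := card_le_card hS
    rw [← card_sdiff_of_subset hS]
    refine ih _ ?_ (fun f hf => hu f (mem_sdiff.1 hf).1) (hE.mono sdiff_subset)
      (subset_sdiff_of_mem hV) rfl
    rw [card_sdiff_of_subset hS]
    omega
  rcases sparse_or_star hr hu hE hV hne with h | h
  · obtain ⟨S, hS, hSc, hi⟩ := h.exists_card_eq
    have h1 := card_sdiff_inc (E := E) S
    have h2 := hrest S hS (card_pos.1 (by omega))
    have h3 := card_le_card hS
    rcases Nat.eq_or_lt_of_le h3 with heq | hlt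
    · have := card_le_card (card_le_one_of_card_eq hu hV (by omega))
      rw [card_singleton] at this
      exact this.trans (le_max_of_le_right (by omega))
    · have h4 := bound_add_le hr (show 1 ≤ V.card - S.card by omega)
      rw [show V.card - S.card + r = V.card by omega] at h4
      omega
  · obtain ⟨D, hD, hD0, hi, -⟩ := h
    have h1 := card_sdiff_inc (E := E) D
    have h2 := hrest D hD.1 hD0
    have h3 := card_lt_card hD
    have h4 := bound_le_sub_one hr (show 1 ≤ V.card - D.card by omega)
    exact le_max_of_le_right (by omega)

/-- Extremal hypergraphs for the linear bound: all hyperedges share `r - 1` vertices. -/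
theorem exists_core_of_card_eq (hr : 2 < r) (hu : ∀ f ∈ E, f.card = r) (hE : CycleFree E r)
    (hV : ∀ f ∈ E, f ⊆ V) (hc : E.card = V.card + 1 - r)
    (hlt : (V.card - 1) / r * (r - 1) < V.card + 1 - r) :
    ∃ K : Finset α, K.card = r - 1 ∧ ∀ f ∈ E, K ⊆ f := by
  have hne : E.Nonempty := card_pos.1 (by omega)
  have hrest : ∀ S ⊆ V, (E \ inc E S).card ≤ bound r (V.card - S.card) := by
    intro S hS
    rw [← card_sdiff_of_subset hS]
    exact card_le_bound hr (fun f hf => hu f (mem_sdiff.1 hf).1) (hE.mono sdiff_subset)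
      (subset_sdiff_of_mem hV)
  rcases sparse_or_star hr hu hE hV hne with h | h
  · obtain ⟨S, hS, hSc, hi⟩ := h.exists_card_eq
    have h1 := card_sdiff_inc (E := E) S
    have h2 := hrest S hS
    have h3 := card_le_card hS
    rcases Nat.eq_or_lt_of_le h3 with heq | hlt'
    · obtain ⟨K, hK, hKc⟩ := exists_subset_card_eq (show r - 1 ≤ V.card by omega)
      refine ⟨K, hKc, fun f hf => ?_⟩
      rwa [mem_singleton.1 (card_le_one_of_card_eq hu hV (by omega) hf)]
    -- Removing a sparse set would leave too few hyperedges: the first term falls short by `hlt`,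
    -- the linear one by counting.
    · have h4 := sub_one_div_mul_step hr (show 1 ≤ V.card - S.card by omega)
      rw [show V.card - S.card + r = V.card by omega] at h4
      simp only [bound] at h2
      omega
  · obtain ⟨D, hD, hD0, hi, hK⟩ := h
    have h1 := card_sdiff_inc (E := E) D
    have h2 := hrest D hD.1
    have h3 := card_lt_card hD
    refine hK ?_
    rw [card_sdiff_of_subset hD.1]
    by_contra hne1
    have h4 := bound_lt_sub_one hr (show 2 ≤ V.card - D.card by omega)
    omega

end Bound

/-! ### Connectivity and 2-connectivity through cuts -/

section Connectivity

/-- `X` is nonempty and every cut of `X` is crossed by the relation `R`. -/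
def Conn {α : Type*} (R : α → α → Prop) (X : Set α) : Prop :=
  X.Nonempty ∧ ∀ A ⊆ X, A.Nonempty → (X \ A).Nonempty → ∃ a ∈ A, ∃ b ∈ X \ A, R a b

/-- At least three elements, connected, and connected after the deletion of any element. -/
def TwoConn {α : Type*} (R : α → α → Prop) (X : Set α) : Prop :=
  3 ≤ X.encard ∧ Conn R X ∧ ∀ x ∈ X, Conn R (X \ {x})

variable {α : Type*} {R R' : α → α → Prop} {X Y : Set α}

theorem Conn.mono (h : Conn R X) (hR : ∀ a ∈ X, ∀ b ∈ X, a ≠ b → R a b → R' a b) :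
    Conn R' X := by
  refine ⟨h.1, fun A hA hA0 hA1 => ?_⟩
  obtain ⟨a, ha, b, hb, hab⟩ := h.2 A hA hA0 hA1
  exact ⟨a, ha, b, hb, hR a (hA ha) b hb.1 (fun hab => hb.2 (hab ▸ ha)) hab⟩

theorem TwoConn.mono (h : TwoConn R X) (hR : ∀ a ∈ X, ∀ b ∈ X, a ≠ b → R a b → R' a b) :
    TwoConn R' X :=
  ⟨h.1, h.2.1.mono hR, fun x hx => (h.2.2 x hx).mono fun a ha b hb => hR a ha.1 b hb.1⟩

theorem conn_of_clique (h0 : X.Nonempty) (h : ∀ a ∈ X, ∀ b ∈ X, R a b) : Conn R X :=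
  ⟨h0, fun _ hA ⟨a, ha⟩ ⟨b, hb⟩ => ⟨a, ha, b, hb, h a (hA ha) b hb.1⟩⟩

theorem Conn.union (hX : Conn R X) (hY : Conn R Y)
    (h : (X ∩ Y).Nonempty) : Conn R (X ∪ Y) := by
  obtain ⟨z, hzX, hzY⟩ := h
  refine ⟨⟨z, Or.inl hzX⟩, fun A hA ⟨a, ha⟩ ⟨b, hb⟩ => ?_⟩
  by_contra hno
  push Not at hno
  have hX' : ∀ a ∈ X, ∀ b ∈ X, a ∈ A → b ∈ A := by
    intro a haX b hbX haA
    by_contra hbA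
    obtain ⟨c, hc, d, hd, hcd⟩ := hX.2 (A ∩ X) Set.inter_subset_right ⟨a, haA, haX⟩
      ⟨b, hbX, fun h => hbA h.1⟩
    exact hno c hc.1 d ⟨Or.inl hd.1, fun h => hd.2 ⟨h, hd.1⟩⟩ hcd
  have hY' : ∀ a ∈ Y, ∀ b ∈ Y, a ∈ A → b ∈ A := by
    intro a haX b hbX haA
    by_contra hbA
    obtain ⟨c, hc, d, hd, hcd⟩ := hY.2 (A ∩ Y) Set.inter_subset_right ⟨a, haA, haX⟩
      ⟨b, hbX, fun h => hbA h.1⟩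
    exact hno c hc.1 d ⟨Or.inr hd.1, fun h => hd.2 ⟨h, hd.1⟩⟩ hcd
  have hz : z ∈ A := by
    rcases hA ha with h | h
    · exact hX' a h z hzX ha
    · exact hY' a h z hzY ha
  rcases hb.1 with h | h
  · exact hb.2 (hX' z hzX b h hz)
  · exact hb.2 (hY' z hzY b h hz)

theorem twoConn_of_clique (h3 : 3 ≤ X.encard) (h : ∀ a ∈ X, ∀ b ∈ X, R a b) : TwoConn R X := by
  refine ⟨h3, conn_of_clique ?_ h, fun x hx => conn_of_clique ?_ fun a ha b hb => h a ha.1 b hb.1⟩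
  · rw [← Set.encard_pos]
    exact lt_of_lt_of_le (by norm_num) h3
  · rw [← Set.encard_pos]
    rw [← Set.encard_sdiff_singleton_add_one hx] at h3
    by_contra h0
    have : (X \ {x}).encard = 0 := Set.encard_eq_zero.2 (Set.not_nonempty_iff_eq_empty.1 (by simpa using h0))
    rw [this] at h3
    norm_num at h3

/-- Deleting a vertex leaves at least one of the two common vertices, which still joins both parts.
-/
theorem TwoConn.union (hX : TwoConn R X) (hY : TwoConn R Y)
    {x y : α} (hxy : x ≠ y) (hx : x ∈ X ∩ Y) (hy : y ∈ X ∩ Y) : TwoConn R (X ∪ Y) := by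
  have key : ∀ Z, TwoConn R Z → ∀ z, Conn R (Z \ {z}) := by
    intro Z hZ z
    by_cases hz : z ∈ Z
    · exact hZ.2.2 z hz
    · rw [Set.sdiff_singleton_eq_self hz]
      exact hZ.2.1
  refine ⟨hX.1.trans (Set.encard_le_encard Set.subset_union_left), hX.2.1.union hY.2.1 ⟨x, hx⟩,
    fun z _ => ?_⟩
  rw [Set.union_sdiff_distrib]
  refine (key X hX z).union (key Y hY z) ?_
  by_cases hz : x = z
  · exact ⟨y, ⟨hy.1, fun h => hxy (hz.trans h.symm)⟩, ⟨hy.2, fun h => hxy (hz.trans h.symm)⟩⟩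
  · exact ⟨x, ⟨hx.1, hz⟩, ⟨hx.2, hz⟩⟩

theorem conn_chain (f : ℕ → Set α) (k : ℕ)
    (hf : ∀ i ≤ k, Conn R (f i)) (hi : ∀ i < k, (f i ∩ f (i + 1)).Nonempty) :
    Conn R {x | ∃ i ≤ k, x ∈ f i} := by
  induction k with
  | zero =>
    have : {x | ∃ i ≤ 0, x ∈ f i} = f 0 := by ext x; simp
    rw [this]
    exact hf 0 le_rfl
  | succ k ih =>
    have : {x | ∃ i ≤ k + 1, x ∈ f i} = {x | ∃ i ≤ k, x ∈ f i} ∪ f (k + 1) := by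
      ext x
      simp only [Set.mem_ofPred_eq, Set.mem_union]
      constructor
      · rintro ⟨i, hi, hx⟩
        rcases Nat.lt_or_ge i (k + 1) with h | h
        · exact Or.inl ⟨i, by omega, hx⟩
        · rw [show i = k + 1 by omega] at hx
          exact Or.inr hx
      · rintro (⟨i, hi, hx⟩ | hx)
        · exact ⟨i, by omega, hx⟩
        · exact ⟨k + 1, le_rfl, hx⟩
    rw [this]
    obtain ⟨x, hx⟩ := hi k (by omega)
    exact (ih (fun i h => hf i (by omega)) fun i h => hi i (by omega)).union
      (hf (k + 1) le_rfl) ⟨x, ⟨k, le_rfl, hx.1⟩, hx.2⟩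

/-- A walk across a cut has a boundary dart; conversely, the set of vertices reachable from one
point is a cut that no edge leaves. The map `f` transfers graphs on nested subtypes to sets in one
ambient type. -/
theorem connected_iff_conn {W : Type*} {G : SimpleGraph W} (f : W → α)
    (hf : Function.Injective f) (hG : ∀ a b, G.Adj a b ↔ a ≠ b ∧ R (f a) (f b)) :
    G.Connected ↔ Conn R (Set.range f) := by
  constructor
  · intro h
    obtain ⟨w⟩ := h.nonempty
    refine ⟨⟨f w, w, rfl⟩, fun A hA ⟨a, ha⟩ ⟨b, ⟨y, hy⟩, hb⟩ => ?_⟩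
    obtain ⟨x, rfl⟩ := hA ha
    subst hy
    obtain ⟨p⟩ := h.preconnected x y
    obtain ⟨d, -, hd1, hd2⟩ := p.exists_boundary_dart (f ⁻¹' A) ha hb
    exact ⟨f d.fst, hd1, f d.snd, ⟨⟨_, rfl⟩, hd2⟩, ((hG _ _).1 d.adj).2⟩
  · rintro ⟨⟨-, w, -⟩, h⟩
    refine (SimpleGraph.connected_iff _).2 ⟨fun x y => ?_, ⟨w⟩⟩
    by_contra hxy
    obtain ⟨-, ⟨a, ha, rfl⟩, -, ⟨⟨b, rfl⟩, hb⟩, hab⟩ := h (f '' {z | G.Reachable x z})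
      (Set.image_subset_range _ _) ⟨f x, x, SimpleGraph.Reachable.refl _, rfl⟩
      ⟨f y, ⟨y, rfl⟩, fun ⟨z, hz, hzy⟩ => hxy (hf hzy ▸ hz)⟩
    have hb' : ¬ G.Reachable x b := fun hr => hb ⟨b, hr, rfl⟩
    refine hb' (SimpleGraph.Reachable.trans ha ?_)
    refine SimpleGraph.Adj.reachable ((hG _ _).2 ⟨fun hab => ?_, hab⟩)
    exact hb' (hab ▸ ha)

theorem isTwoConnected_iff_twoConn {W : Type*} {G : SimpleGraph W} (f : W → α)
    (hf : Function.Injective f) (hG : ∀ a b, G.Adj a b ↔ a ≠ b ∧ R (f a) (f b)) :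
    IsTwoConnected G ↔ TwoConn R (Set.range f) := by
  have h1 : ENat.card W = (Set.range f).encard := by
    rw [← Set.image_univ, hf.encard_image, Set.encard_univ]
  have h2 : ∀ w, (G.induce {w}ᶜ).Connected ↔ Conn R (Set.range f \ {f w}) := by
    intro w
    rw [connected_iff_conn (R := R) (fun x : ({w}ᶜ : Set W) => f x)
      (hf.comp Subtype.val_injective)]
    · have : Set.range (fun x : ({w}ᶜ : Set W) => f x) = Set.range f \ {f w} := by
        ext y
        constructor
        · rintro ⟨⟨x, hx⟩, rfl⟩
          exact ⟨⟨x, rfl⟩, fun h => hx (hf h)⟩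
        · rintro ⟨⟨x, rfl⟩, hx⟩
          exact ⟨⟨x, fun h => hx (congrArg f h)⟩, rfl⟩
      rw [this]
    · rintro ⟨a, ha⟩ ⟨b, hb⟩
      simpa [Subtype.ext_iff] using hG a b
  rw [IsTwoConnected, TwoConn, h1, connected_iff_conn f hf hG]
  simp only [h2, Set.forall_mem_range]

end Connectivity

/-! ### Long Berge paths between prescribed vertices -/

section LongPaths

open Finset

/-- A Berge path `w 0, e 0, w 1, …, e (k - 1), w k` with `k` hyperedges from `u` to `v`. -/
structure IsLink {α : Type*} (E : Finset (Finset α)) (u v : α) (k : ℕ) (w : ℕ → α)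
    (e : ℕ → Finset α) : Prop where
  first : w 0 = u
  last : w k = v
  winj : ∀ i ≤ k, ∀ j ≤ k, w i = w j → i = j
  einj : ∀ i < k, ∀ j < k, e i = e j → i = j
  mem : ∀ i < k, e i ∈ E
  left : ∀ i < k, w i ∈ e i
  right : ∀ i < k, w (i + 1) ∈ e i

variable {α : Type*} {E E' : Finset (Finset α)} {u v x : α} {k l r : ℕ} {w w' : ℕ → α}
  {e e' : ℕ → Finset α} {V V' : Finset α}

theorem IsLink.vertex_mem (h : IsLink E u v k w e) (hk : 0 < k) (hV : ∀ f ∈ E, f ⊆ V) :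
    ∀ i ≤ k, w i ∈ V := by
  intro i hi
  rcases Nat.lt_or_ge i k with hlt | hge
  · exact hV _ (h.mem i hlt) (h.left i hlt)
  · obtain ⟨k, rfl⟩ := Nat.exists_eq_succ_of_ne_zero hk.ne'
    rw [show i = k + 1 by omega]
    exact hV _ (h.mem k (by omega)) (h.right k (by omega))

theorem IsLink.symm (h : IsLink E u v k w e) :
    IsLink E v u k (fun i => w (k - i)) (fun i => e (k - 1 - i)) := by
  refine ⟨by simpa using h.last, by simpa using h.first, fun i hi j hj hij => ?_,
    fun i hi j hj hij => ?_, fun i hi => h.mem _ (by omega), fun i hi => ?_, fun i hi => ?_⟩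
  · have := h.winj _ (by omega) _ (by omega) hij
    omega
  · have := h.einj _ (by omega) _ (by omega) hij
    omega
  · have := h.right (k - 1 - i) (by omega)
    rwa [show k - 1 - i + 1 = k - i by omega] at this
  · have := h.left (k - 1 - i) (by omega)
    rwa [show k - 1 - i = k - (i + 1) by omega] at this ⊢

theorem IsLink.mono (h : IsLink E u v k w e) (hE : E ⊆ E') : IsLink E' u v k w e :=
  { h with mem := fun i hi => hE (h.mem i hi) }

theorem IsLink.append (h : IsLink E u v k w e) (h' : IsLink E v x l w' e')
    (hw : ∀ i < k, ∀ j ≤ l, w i ≠ w' j) (he : ∀ i < k, ∀ j < l, e i ≠ e' j) :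
    IsLink E u x (k + l) (fun i => if i < k then w i else w' (i - k))
      (fun i => if i < k then e i else e' (i - k)) := by
  have h0 : w' 0 = w k := h'.first.trans h.last.symm
  constructor
  · rcases Nat.eq_zero_or_pos k with rfl | hk
    · simpa [h0] using h.first
    · simpa [hk] using h.first
  · simpa using h'.last
  · intro i hi j hj hij
    have a1 := h.winj i
    have a2 := h'.winj (i - k)
    have a3 := hw i
    have a4 := hw j
    grind
  · intro i hi j hj hij
    have a1 := h.einj i
    have a2 := h'.einj (i - k)
    have a3 := he i
    have a4 := he j
    grind
  · intro i hi
    have a1 := h.mem i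
    have a2 := h'.mem (i - k)
    grind
  · intro i hi
    have a1 := h.left i
    have a2 := h'.left (i - k)
    grind
  · intro i hi
    have a1 := h.right i
    have a2 := h'.right (i - k)
    grind

/-- A hyperedge that closes a path to a cycle bounds its length. -/
theorem IsLink.lt_of_close (h : IsLink E u v k w e) (hE : CycleFree E r) {f : Finset α}
    (hf : f ∈ E) (hfe : ∀ i < k, f ≠ e i) (hu : u ∈ f) (hv : v ∈ f) : k + 1 < r := by
  by_contra hr
  have a1 := h.first
  have a2 := h.last
  refine hE (k + 1) (by omega) (fun i => if i = 0 then f else e (i - 1)) w ?_ ?_ ?_ ?_ ?_ ?_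
  · intro i hi
    have := h.mem (i - 1)
    grind
  · intro i hi j hj hij
    have := h.einj (i - 1)
    have := hfe (i - 1)
    have := hfe (j - 1)
    grind
  · intro i hi j hj hij
    exact h.winj i (by omega) j (by omega) hij
  · intro i hi
    have := h.right (i - 1)
    grind
  · intro i hi
    have := h.left i
    grind
  · simpa [a2] using hv

/-- Any two vertices are joined by a Berge path with at least `s` hyperedges. -/
def LongLinked (E : Finset (Finset α)) (V : Finset α) (s : ℕ) : Prop :=
  ∀ u ∈ V, ∀ v ∈ V, u ≠ v → ∃ k w e, s ≤ k ∧ IsLink E u v k w e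

variable [DecidableEq α]

/-- `r - 1` hyperedges of size `r` on `r + 1` vertices. -/
theorem longLinked_block (hr : 4 ≤ r) (hu : ∀ f ∈ E, f.card = r) (hV : ∀ f ∈ E, f ⊆ V)
    (hc : V.card = r + 1) (hE : E.card = r - 1) : LongLinked E V (r - 1) := by
  intro u hu' v hv' huv
  -- The vertices are ordered as `w 0, …, w r` with `u` at `0` and `v` at `r - 1`; the path skips `w
  -- r` and uses all `r - 1` hyperedges.
  obtain ⟨g, hg⟩ := Finset.exists_equiv_extend_of_card_eq (α := Fin (r + 1)) (t := V)
    (by simp [hc]) (s := {0, ⟨r - 1, by omega⟩}) (f := fun i => if i = 0 then u else v)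
    (by
      intro y hy
      simp only [image_insert, image_singleton, mem_insert, mem_singleton] at hy
      grind)
    (by
      intro i hi j hj hij
      have : (⟨r - 1, by omega⟩ : Fin (r + 1)) ≠ 0 := by
        intro h
        have := congrArg Fin.val h
        simp at this
        omega
      simp at hi hj hij
      grind)
  have hg0 : (g 0 : α) = u := by simpa using hg 0 (by simp)
  have hg1 : (g ⟨r - 1, by omega⟩ : α) = v := by
    have := hg ⟨r - 1, by omega⟩ (by simp)
    rw [this, if_neg]
    intro h
    have := congrArg Fin.val h
    simp at this
    omega
  set w : ℕ → α := fun i => if h : i < r + 1 then g ⟨i, h⟩ else u with hw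
  have hwg : ∀ i (h : i < r + 1), w i = g ⟨i, h⟩ := fun i h => dif_pos h
  have hwV : ∀ i < r + 1, w i ∈ V := fun i h => by rw [hwg i h]; exact (g _).2
  have hwinj : ∀ i < r + 1, ∀ j < r + 1, w i = w j → i = j := by
    intro i hi j hj hij
    rw [hwg i hi, hwg j hj] at hij
    simpa using g.injective (Subtype.ext hij)
  -- Each hyperedge misses exactly one vertex `w (c f)`, and different hyperedges miss different
  -- vertices.
  have hmiss : ∀ f, ∃ i, f ∈ E → i < r + 1 ∧ V \ f = {w i} := by
    intro f
    by_cases hf : f ∈ E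
    · have : (V \ f).card = 1 := by
        rw [card_sdiff_of_subset (hV f hf), hc, hu f hf]
        omega
      obtain ⟨y, hy⟩ := card_eq_one.1 this
      have hyV : y ∈ V := (mem_sdiff.1 (show y ∈ V \ f by simp [hy])).1
      refine ⟨g.symm ⟨y, hyV⟩, fun _ => ⟨(g.symm ⟨y, hyV⟩).2, ?_⟩⟩
      rw [hwg _ (g.symm ⟨y, hyV⟩).2, hy]
      simp
    · exact ⟨0, fun h => absurd h hf⟩
  choose c hc' using hmiss
  have hcinj : Set.InjOn c E := by
    intro f hf f' hf' hff
    have h1 := (hc' f hf).2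
    have h2 := (hc' f' hf').2
    rw [hff, ← h2] at h1
    rw [← Finset.sdiff_sdiff_eq_self (hV f hf), h1, Finset.sdiff_sdiff_eq_self (hV f' hf')]
  have hmem : ∀ f ∈ E, ∀ i < r + 1, w i ∉ f → i = c f := by
    intro f hf i hi hif
    obtain ⟨h1, h2⟩ := hc' f hf
    have : w i ∈ V \ f := mem_sdiff.2 ⟨hwV i hi, hif⟩
    rw [h2, mem_singleton] at this
    exact hwinj i hi _ h1 this
  set t : Fin (r - 1) → Finset (Finset α) := fun i => E.filter fun f => w i ∈ f ∧ w (i + 1) ∈ f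
    with ht
  -- Hall's theorem assigns to each `i < r - 1` its own hyperedge through `w i` and `w (i + 1)`. A
  -- hyperedge unsuitable for all of `A` has `c f` in `{i, i + 1}` for every `i ∈ A`: at most two
  -- such hyperedges for one index, at most one for two consecutive indices, and none if the indices
  -- spread further. As `r ≥ 4`, enough hyperedges remain.
  obtain ⟨φ, hφ, hφt⟩ := (Finset.all_card_le_biUnion_card_iff_exists_injective t).1 (by
    intro A
    rcases A.eq_empty_or_nonempty with rfl | hA
    · simp
    have hAr : A.card ≤ r - 1 := by simpa using card_le_univ A
    set a := A.min' hA
    set b := A.max' hA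
    have hab : a ≤ b := A.min'_le_max' hA
    have hAab : A ⊆ Icc a b := fun i hi => mem_Icc.2 ⟨A.min'_le i hi, A.le_max' i hi⟩
    have hA1 := card_le_card hAab
    rw [Fin.card_Icc] at hA1
    have hsub : A.biUnion t ⊆ E := biUnion_subset.2 fun i _ => filter_subset _ _
    have hcomp := card_sdiff_add_card_eq_card hsub
    have hmiss : ∀ f ∈ E \ A.biUnion t, ∀ i ∈ A, c f = i ∨ c f = i + 1 := by
      intro f hf i hi
      obtain ⟨hf, hfA⟩ := mem_sdiff.1 hf
      by_contra hno
      push Not at hno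
      refine hfA (mem_biUnion.2 ⟨i, hi, mem_filter.2 ⟨hf, ?_, ?_⟩⟩)
      · by_contra h
        exact hno.1 (hmem f hf i (by omega) h).symm
      · by_contra h
        exact hno.2 (hmem f hf (i + 1) (by omega) h).symm
    have himg : (E \ A.biUnion t).card = ((E \ A.biUnion t).image c).card :=
      (card_image_of_injOn (hcinj.mono fun f hf => (mem_sdiff.1 hf).1)).symm
    have ha := A.min'_mem hA
    have hb := A.max'_mem hA
    rcases Nat.lt_trichotomy (b : ℕ) (a + 1) with h1 | h1 | h1
    · have : (E \ A.biUnion t).image c ⊆ {(a : ℕ), (a : ℕ) + 1} := by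
        intro y hy
        obtain ⟨f, hf, rfl⟩ := mem_image.1 hy
        have := hmiss f hf a ha
        simpa using this
      have h2 := card_le_card this
      have h3 := card_le_two (a := (a : ℕ)) (b := (a : ℕ) + 1)
      have : (a : ℕ) ≤ b := hab
      omega
    · have : (E \ A.biUnion t).image c ⊆ {(b : ℕ)} := by
        intro y hy
        obtain ⟨f, hf, rfl⟩ := mem_image.1 hy
        have h2 := hmiss f hf a ha
        have h3 := hmiss f hf b hb
        rw [mem_singleton]
        omega
      have h2 := card_le_card this
      rw [card_singleton] at h2
      omega
    · have : (E \ A.biUnion t).image c ⊆ ∅ := by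
        intro y hy
        obtain ⟨f, hf, rfl⟩ := mem_image.1 hy
        have h2 := hmiss f hf a ha
        have h3 := hmiss f hf b hb
        omega
      have h2 := card_le_card this
      rw [card_empty] at h2
      omega)
  have hφ' := fun i => mem_filter.1 (hφt i)
  refine ⟨r - 1, w, fun i => if h : i < r - 1 then φ ⟨i, h⟩ else ∅, le_rfl, ?_, ?_, ?_, ?_, ?_, ?_,
    ?_⟩
  · rw [hwg 0 (by omega)]
    exact hg0
  · rw [hwg (r - 1) (by omega)]
    exact hg1
  · intro i hi j hj hij
    exact hwinj i (by omega) j (by omega) hij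
  · intro i hi j hj hij
    simp only [hi, hj, dif_pos] at hij
    simpa using hφ hij
  · intro i hi
    simpa only [hi, dif_pos] using (hφ' ⟨i, hi⟩).1
  · intro i hi
    simpa only [hi, dif_pos] using (hφ' ⟨i, hi⟩).2.1
  · intro i hi
    simpa only [hi, dif_pos] using (hφ' ⟨i, hi⟩).2.2

end LongPaths

/-! ### Peeling off blocks one at a time -/

section TreeLike

open Finset

/-- Two vertices lie in a common hyperedge. -/
def EdgeAdj {α : Type*} (E : Finset (Finset α)) (x y : α) : Prop := ∃ f ∈ E, x ∈ f ∧ y ∈ f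

variable {α : Type*} {E : Finset (Finset α)} {V : Finset α} {r : ℕ}

theorem edgeAdj_clique {f : Finset α} (hf : f ∈ E) :
    ∀ a ∈ (f : Set α), ∀ b ∈ (f : Set α), EdgeAdj E a b :=
  fun _ ha _ hb => ⟨f, hf, ha, hb⟩

variable [DecidableEq α]

/-- The connectivity properties of `(r + 1, r - 1)`-block trees. -/
structure TreeLike (E : Finset (Finset α)) (V : Finset α) (r : ℕ) : Prop where
  conn : Conn (EdgeAdj E) V
  block : ∀ B : Set α, B ⊆ V → TwoConn (EdgeAdj E) B →
    ∃ C : Finset α, B ⊆ C ∧ C ⊆ V ∧ C.card = r + 1 ∧ (E.filter (· ⊆ C)).card = r - 1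
  long : LongLinked E V (r - 1)

theorem union_eq_of_card {f g B : Finset α} (hf : f ⊆ B) (hg : g ⊆ B) (hfg : f ≠ g)
    (hfc : f.card = r) (hgc : g.card = r) (hB : B.card = r + 1) : f ∪ g = B := by
  refine eq_of_subset_of_card_le (union_subset hf hg) ?_
  by_contra hlt
  have h1 : f = f ∪ g := eq_of_subset_of_card_le subset_union_left (by omega)
  have h2 : g ⊆ f := by rw [h1]; exact subset_union_right
  exact hfg (eq_of_subset_of_card_le h2 (by omega)).symm

/-- If the hyperedges that meet `S` are attached to a `TreeLike` rest, then they span `S` and a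
single further vertex. -/
theorem exists_attachment (hr : 2 < r) (hu : ∀ f ∈ E, f.card = r) (hE : CycleFree E r)
    (hV : ∀ f ∈ E, f ⊆ V) {S : Finset α} (hSc : S.card = r)
    (hi : (inc E S).card = r - 1) (hT : LongLinked (E \ inc E S) (V \ S) (r - 1)) :
    ∃ y ∈ V \ S, ∀ f ∈ inc E S, f ⊆ insert y S := by
  have hVT := subset_sdiff_of_mem hV (S := S)
  have hinE : ∀ f ∈ inc E S, f ∈ E := fun f hf => (mem_inc.1 hf).1
  -- Two vertices of `f` outside `S` are joined by at least `r - 1` hyperedges of the rest, and `f`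
  -- closes a long cycle.
  have hone : ∀ f ∈ inc E S, ∀ u ∈ f, u ∉ S → ∀ v ∈ f, v ∉ S → u = v := by
    intro f hf u hu' huS v hv hvS
    by_contra huv
    have hfE := hinE f hf
    obtain ⟨k, w, e, hk, h⟩ := hT u (mem_sdiff.2 ⟨hV f hfE hu', huS⟩) v
      (mem_sdiff.2 ⟨hV f hfE hv, hvS⟩) huv
    have := (h.mono sdiff_subset).lt_of_close hE hfE (fun i hi h' =>
      (mem_sdiff.1 (h.mem i hi)).2 (h' ▸ hf)) hu' hv
    omega
  have hsmall : ∀ f ∈ inc E S, r - 1 ≤ (f ∩ S).card := by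
    intro f hf
    have h1 := card_sdiff_add_card_inter f S
    rw [hu f (hinE f hf)] at h1
    have h2 : (f \ S).card ≤ 1 := card_le_one.2 fun a ha b hb =>
      hone f hf a (mem_sdiff.1 ha).1 (mem_sdiff.1 ha).2 b (mem_sdiff.1 hb).1 (mem_sdiff.1 hb).2
    omega
  -- Two hyperedges leaving `S` at different vertices each contain at least `r - 1` of the `r`
  -- vertices of `S`, so they meet in `S`; there they close a long path of the rest.
  have htwo : ∀ f ∈ inc E S, ∀ g ∈ inc E S, ∀ u ∈ g, u ∉ S → ∀ v ∈ f, v ∉ S → u = v := by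
    intro f hf g hg u hu' huS v hv hvS
    by_contra huv
    have hfg : f ≠ g := by
      rintro rfl
      exact huv (hone f hf u hu' huS v hv hvS)
    have hint : ((f ∩ S) ∩ (g ∩ S)).Nonempty := by
      rw [← card_pos]
      have h1 := card_union_add_card_inter (f ∩ S) (g ∩ S)
      have h2 := card_le_card (union_subset (inter_subset_right (s₁ := f) (s₂ := S))
        (inter_subset_right (s₁ := g) (s₂ := S)))
      have h3 := hsmall f hf
      have h4 := hsmall g hg
      omega
    obtain ⟨s, hs⟩ := hint
    simp only [mem_inter] at hs
    obtain ⟨⟨hsf, hsS⟩, hsg, -⟩ := hs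
    obtain ⟨k, w, e, hk, h⟩ := hT u (mem_sdiff.2 ⟨hV g (hinE g hg) hu', huS⟩) v
      (mem_sdiff.2 ⟨hV f (hinE f hf) hv, hvS⟩) huv
    have hwT := h.vertex_mem (by omega) hVT
    have hlink : IsLink E v s 1 (fun i => if i = 0 then v else s) (fun _ => f) := by
      have hvs : v ≠ s := fun h => hvS (h ▸ hsS)
      refine ⟨by simp, by simp, ?_, by omega, fun _ _ => hinE f hf, ?_, ?_⟩
      · intro i hi j hj hij
        grind
      · intro i hi
        simpa [show i = 0 by omega] using hv
      · intro i hi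
        simpa using hsf
    have happ := (h.mono sdiff_subset).append hlink (by
      intro i hi j hj hij
      split_ifs at hij with h0
      · have := h.winj i hi.le k le_rfl (hij.trans h.last.symm)
        omega
      · exact (mem_sdiff.1 (hwT i hi.le)).2 (hij ▸ hsS)) (by
      intro i hi j hj hij
      exact (mem_sdiff.1 (h.mem i hi)).2 (hij ▸ hf))
    have := happ.lt_of_close hE (hinE g hg) (by
      intro i hi hgi
      split_ifs at hgi with h0
      · exact (mem_sdiff.1 (h.mem i h0)).2 (hgi ▸ hg)
      · exact hfg hgi.symm) hu' hsg
    omega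
  have hex : ∃ f ∈ inc E S, ∃ y ∈ f, y ∉ S := by
    by_contra hno
    push Not at hno
    have : inc E S ⊆ {S} := fun f hf => mem_singleton.2
      (eq_of_subset_of_card_le (fun y hy => hno f hf y hy) (by rw [hSc, hu f (hinE f hf)]))
    have := card_le_card this
    rw [card_singleton] at this
    omega
  obtain ⟨f, hf, y, hyf, hyS⟩ := hex
  refine ⟨y, mem_sdiff.2 ⟨hV f (hinE f hf) hyf, hyS⟩, fun g hg z hz => ?_⟩
  by_cases hzS : z ∈ S
  · exact mem_insert_of_mem hzS
  · rw [htwo f hf g hg z hz hzS y hyf hyS]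
    exact mem_insert_self _ _

/-- The new block `insert y S` meets the rest in the cut vertex `y` only. Hence no 2-connected set
reaches both sides, and long paths between the sides are concatenated at `y`. -/
theorem TreeLike.attach (hr : 4 ≤ r) (hu : ∀ f ∈ E, f.card = r)
    (hV : ∀ f ∈ E, f ⊆ V) {S : Finset α} (hSV : S ⊆ V) (hSc : S.card = r)
    (hi : (inc E S).card = r - 1) (hT : TreeLike (E \ inc E S) (V \ S) r) {y : α}
    (hy : y ∈ V \ S) (hyF : ∀ f ∈ inc E S, f ⊆ insert y S) : TreeLike E V r := by
  obtain ⟨hyV, hyS⟩ := mem_sdiff.1 hy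
  have hVT := subset_sdiff_of_mem hV (S := S)
  have hinE : ∀ f ∈ inc E S, f ∈ E := fun f hf => (mem_inc.1 hf).1
  have hCc : (insert y S).card = r + 1 := by rw [card_insert_of_notMem hyS, hSc]
  have hCV : insert y S ⊆ V := insert_subset hyV hSV
  have hlC := longLinked_block hr (fun f hf => hu f (hinE f hf)) hyF hCc hi
  have hcases : ∀ x ∈ V, x ∈ insert y S ∨ x ∈ V \ S := by
    intro x hx
    by_cases hxS : x ∈ S
    · exact Or.inl (mem_insert_of_mem hxS)
    · exact Or.inr (mem_sdiff.2 ⟨hx, hxS⟩)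
  -- The hyperedges of the new block have at most the vertex `y` in the rest, so they create no
  -- adjacency there.
  have hadj : ∀ a ∈ V \ S, ∀ b ∈ V \ S, a ≠ b → EdgeAdj E a b → EdgeAdj (E \ inc E S) a b := by
    rintro a ha b hb hab ⟨f, hf, haf, hbf⟩
    refine ⟨f, mem_sdiff.2 ⟨hf, fun hfi => hab ?_⟩, haf, hbf⟩
    have h1 := (mem_insert.1 (hyF f hfi haf)).resolve_right (mem_sdiff.1 ha).2
    have h2 := (mem_insert.1 (hyF f hfi hbf)).resolve_right (mem_sdiff.1 hb).2
    exact h1.trans h2.symm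
  constructor
  · obtain ⟨f, hf, g, hg, hfg⟩ := one_lt_card.1 (show 1 < (inc E S).card by omega)
    have hfgC := union_eq_of_card (hyF f hf) (hyF g hg) hfg (hu f (hinE f hf)) (hu g (hinE g hg))
      hCc
    have hne : ((f : Set α) ∩ g).Nonempty := by
      rw [← coe_inter, coe_nonempty, ← card_pos]
      have h1 := card_union_add_card_inter f g
      rw [hfgC, hCc, hu f (hinE f hf), hu g (hinE g hg)] at h1
      omega
    have hCconn : Conn (EdgeAdj E) ((insert y S : Finset α) : Set α) := by
      rw [← hfgC, coe_union]
      refine (conn_of_clique ?_ (edgeAdj_clique (hinE f hf))).union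
        (conn_of_clique ?_ (edgeAdj_clique (hinE g hg))) hne
      · exact hne.mono Set.inter_subset_left
      · exact hne.mono Set.inter_subset_right
    have hTconn : Conn (EdgeAdj E) ((V \ S : Finset α) : Set α) :=
      hT.conn.mono fun a _ b _ _ ⟨f, hf, h⟩ => ⟨f, (mem_sdiff.1 hf).1, h⟩
    have : (V : Set α) = ((V \ S : Finset α) : Set α) ∪ ((insert y S : Finset α) : Set α) := by
      rw [← coe_union]
      congr 1
      ext x
      simp only [mem_union]
      exact ⟨fun hx => (hcases x hx).symm, fun hx => hx.elim (fun h => (mem_sdiff.1 h).1)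
        fun h => hCV h⟩
    rw [this]
    exact hTconn.union hCconn ⟨y, hy, mem_coe.2 (mem_insert_self _ _)⟩
  · intro B hBV hB
    by_cases hBT : B ⊆ ((V \ S : Finset α) : Set α)
    · obtain ⟨C, hBC, hCT, hCc', hCe⟩ := hT.block B hBT
        (hB.mono fun a ha b hb => hadj a (hBT ha) b (hBT hb))
      refine ⟨C, hBC, hCT.trans sdiff_subset, hCc', ?_⟩
      rw [← hCe]
      congr 1
      ext f
      simp only [mem_filter, mem_sdiff]
      refine ⟨fun ⟨hf, hfC⟩ => ⟨⟨hf, fun hfi => ?_⟩, hfC⟩, fun ⟨⟨hf, _⟩, hfC⟩ => ⟨hf, hfC⟩⟩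
      obtain ⟨-, x, hx, hxS⟩ := mem_inc.1 hfi
      exact (mem_sdiff.1 (hCT (hfC hx))).2 hxS
    by_cases hBC : B ⊆ ((insert y S : Finset α) : Set α)
    · refine ⟨insert y S, hBC, hCV, hCc, ?_⟩
      rw [← hi]
      congr 1
      ext f
      rw [mem_filter]
      refine ⟨fun ⟨hf, hfC⟩ => ?_, fun hf => ⟨hinE f hf, hyF f hf⟩⟩
      by_contra hfi
      have : f ⊆ {y} := fun x hx => mem_singleton.2
        ((mem_insert.1 (hfC hx)).resolve_right fun hxS => hfi (mem_inc.2 ⟨hf, x, hx, hxS⟩))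
      have := card_le_card this
      rw [card_singleton, hu f hf] at this
      omega
    exfalso
    obtain ⟨s, hsB, hsT⟩ := Set.not_subset.1 hBT
    obtain ⟨t, htB, htC⟩ := Set.not_subset.1 hBC
    have hsS : s ∈ S := by
      by_contra h
      exact hsT (mem_coe.2 (mem_sdiff.2 ⟨hBV hsB, h⟩))
    have htC' : t ∉ insert y S := fun h => htC (mem_coe.2 h)
    have htS : t ∉ S := fun h => htC' (mem_insert_of_mem h)
    have hconn : Conn (EdgeAdj E) (B \ {y}) := by
      by_cases hyB : y ∈ B
      · exact hB.2.2 y hyB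
      · rw [Set.sdiff_singleton_eq_self hyB]
        exact hB.2.1
    obtain ⟨a, ha, b, hb, f, hf, haf, hbf⟩ := hconn.2 ((B \ {y}) ∩ S) Set.inter_subset_left
      ⟨s, ⟨hsB, fun h => hyS (h ▸ hsS)⟩, hsS⟩
      ⟨t, ⟨htB, fun h => htC' (h ▸ mem_insert_self _ _)⟩, fun h => htS h.2⟩
    rcases mem_insert.1 (hyF f (mem_inc.2 ⟨hf, a, haf, ha.2⟩) hbf) with h | h
    · exact hb.1.2 h
    · exact hb.2 ⟨hb.1, h⟩
  · have hmix : ∀ u ∈ insert y S, ∀ v ∈ V \ S, v ≠ y →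
        ∃ k w e, r - 1 ≤ k ∧ IsLink E u v k w e := by
      intro u hu' v hv hvy
      obtain ⟨l, w', e', hl, h'⟩ := hT.long y hy v hv hvy.symm
      by_cases huy : u = y
      · subst huy
        exact ⟨l, w', e', hl, h'.mono sdiff_subset⟩
      obtain ⟨k, w, e, hk, h⟩ := hlC u hu' y (mem_insert_self _ _) huy
      refine ⟨_, _, _, ?_, (h.mono (filter_subset _ _)).append (h'.mono sdiff_subset) ?_ ?_⟩
      · omega
      · intro i hi j hj hij
        have h1 := h.vertex_mem (by omega) hyF i hi.le
        have h2 := h'.vertex_mem (by omega) hVT j hj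
        rw [← hij] at h2
        have h3 := (mem_insert.1 h1).resolve_right (mem_sdiff.1 h2).2
        have := h.winj i hi.le k le_rfl (h3.trans h.last.symm)
        omega
      · intro i hi j hj hij
        exact (mem_sdiff.1 (h'.mem j hj)).2 (hij ▸ h.mem i hi)
    intro u hu' v hv huv
    rcases hcases u hu' with h1 | h1 <;> rcases hcases v hv with h2 | h2
    · obtain ⟨k, w, e, hk, h⟩ := hlC u h1 v h2 huv
      exact ⟨k, w, e, hk, h.mono (filter_subset _ _)⟩
    · by_cases hvy : v = y
      · subst hvy
        obtain ⟨k, w, e, hk, h⟩ := hlC u h1 v (mem_insert_self _ _) huv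
        exact ⟨k, w, e, hk, h.mono (filter_subset _ _)⟩
      · exact hmix u h1 v h2 hvy
    · by_cases huy : u = y
      · subst huy
        obtain ⟨k, w, e, hk, h⟩ := hlC u (mem_insert_self _ _) v h2 huv
        exact ⟨k, w, e, hk, h.mono (filter_subset _ _)⟩
      · obtain ⟨k, w, e, hk, h⟩ := hmix v h2 u h1 huy
        exact ⟨k, _, _, hk, h.symm⟩
    · obtain ⟨k, w, e, hk, h⟩ := hT.long u h1 v h2 huv
      exact ⟨k, w, e, hk, h.mono sdiff_subset⟩

/-- Hypergraphs that attain the bound for block trees are block trees. -/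
theorem treeLike_of_card_eq (hr : 2 < r) (hu : ∀ f ∈ E, f.card = r) (hE : CycleFree E r)
    (hV : ∀ f ∈ E, f ⊆ V) (q : ℕ) (hq : q + 2 < r) (hc : V.card = q * r + 1)
    (hEc : E.card = q * (r - 1)) : TreeLike E V r := by
  induction q generalizing E V with
  | zero =>
    obtain ⟨a, rfl⟩ := card_eq_one.1 (show V.card = 1 by simpa using hc)
    refine ⟨⟨⟨a, by simp⟩, ?_⟩, ?_, ?_⟩
    · intro A hA ⟨b, hb⟩ ⟨c, hc, hcA⟩
      have h1 : b = a := by simpa using hA hb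
      have h2 : c = a := by simpa using hc
      exact absurd (h2 ▸ h1 ▸ hb) hcA
    · intro B hB hB2
      have h1 := Set.encard_le_encard hB
      have h2 := hB2.1.trans h1
      simp at h2
    · intro u hu' v hv huv
      exact absurd ((mem_singleton.1 hu').trans (mem_singleton.1 hv).symm) huv
  | succ q ih =>
    have hr4 : 4 ≤ r := by omega
    have hne : E.Nonempty := card_pos.1 (by
      rw [hEc]; exact Nat.mul_pos (by omega) (by omega))
    have hr1 : r * q = (r - 1) * q + q := by
      obtain ⟨r, rfl⟩ := Nat.exists_eq_succ_of_ne_zero (show r ≠ 0 by omega)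
      simp [Nat.succ_mul]
    have hqr : q * r = q * (r - 1) + q := by rw [mul_comm, hr1, mul_comm]
    rw [Nat.succ_mul] at hc hEc
    rcases sparse_or_star hr hu hE hV hne with h | h
    · obtain ⟨S, hS, hSc, hi⟩ := h.exists_card_eq
      have h1 := card_sdiff_inc (E := E) S
      have h2 : (V \ S).card = q * r + 1 := by rw [card_sdiff_of_subset hS]; omega
      have h3 := card_le_bound hr (fun f hf => hu f (mem_sdiff.1 hf).1) (hE.mono sdiff_subset)
        (subset_sdiff_of_mem hV (S := S))
      -- Since `q` is small, the block term dominates for the rest too; so the rest is again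
      -- extremal and `S` meets exactly `r - 1` hyperedges.
      have h4 : bound r (V \ S).card = q * (r - 1) := by
        rw [h2, bound, Nat.add_sub_cancel, Nat.mul_div_cancel _ (by omega)]
        exact max_eq_left (by omega)
      have hT := ih (fun f hf => hu f (mem_sdiff.1 hf).1) (hE.mono sdiff_subset)
        (subset_sdiff_of_mem hV (S := S)) (by omega) h2 (by omega)
      obtain ⟨y, hy, hyF⟩ := exists_attachment hr hu hE hV hSc (by omega) hT.long
      exact hT.attach hr4 hu hV hS hSc (by omega) hy hyF
    -- A star set would allow at most `|V| - r + 1 = q * r + 2` hyperedges, fewer than `(q + 1) * (r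
    -- - 1)` because `q + 3 < r`.
    · exfalso
      obtain ⟨D, hD, hD0, hi, -⟩ := h
      have h1 := card_sdiff_inc (E := E) D
      have h3 := card_lt_card hD
      have h2 := card_le_bound hr (fun f hf => hu f (mem_sdiff.1 hf).1) (hE.mono sdiff_subset)
        (subset_sdiff_of_mem hV (S := D))
      rw [card_sdiff_of_subset hD.1] at h2
      have h4 := bound_le_sub_one hr (show 1 ≤ V.card - D.card by omega)
      omega

end TreeLike

/-! ### Counting in block trees -/

section Blocks

open Finset

variable {α : Type*} {E : Finset (Finset α)} {r : ℕ}

/-- The union of the hyperedges of a Berge cycle is 2-connected. -/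
theorem twoConn_cycle (hr : 3 ≤ r) (hu : ∀ f ∈ E, f.card = r) {t : ℕ} (ht : 2 ≤ t)
    {e : ℕ → Finset α} {v : ℕ → α} (he : ∀ i < t, e i ∈ E)
    (hv : ∀ i < t, ∀ j < t, v i = v j → i = j) (hl : ∀ i < t, v i ∈ e i)
    (hn : ∀ i, i + 1 < t → v i ∈ e (i + 1)) (hlast : v (t - 1) ∈ e 0) :
    TwoConn (EdgeAdj E) {x | ∃ i < t, x ∈ e i} := by
  have hcard : ∀ i < t, 3 ≤ ((e i : Finset α) : Set α).encard := fun i hi => by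
    rw [Set.encard_coe_eq_coe_finsetCard, hu _ (he i hi)]
    exact_mod_cast hr
  have h2 : ∀ i < t, TwoConn (EdgeAdj E) (e i) := fun i hi =>
    twoConn_of_clique (hcard i hi) (edgeAdj_clique (he i hi))
  have key : ∀ Z : Set α, (∀ i < t, Conn (EdgeAdj E) (e i \ Z)) →
      (∃ j < t, ∀ p < t, p ≠ j → v p ∉ Z) →
      Conn (EdgeAdj E) ({x | ∃ i < t, x ∈ e i} \ Z) := by
    rintro Z hZ ⟨j, hj, hjZ⟩
    -- At most the link `v j` is deleted, so the cycle is cut there: `s` runs through the hyperedges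
    -- cyclically from `e (j + 1)` to `e j`, and consecutive ones still share a link.
    set s : ℕ → ℕ := fun i => if j + 1 + i < t then j + 1 + i else j + 1 + i - t with hs
    have hst : ∀ i ≤ t - 1, s i < t := fun i hi => by simp only [hs]; split_ifs <;> omega
    have := conn_chain (R := EdgeAdj E) (fun i => (e (s i) : Set α) \ Z) (t - 1)
      (fun i hi => hZ _ (hst i hi)) (fun i hi => by
        refine ⟨v (s i), ⟨hl _ (hst i (by omega)), ?_⟩, ?_, ?_⟩
        · refine hjZ _ (hst i (by omega)) ?_
          simp only [hs]; split_ifs <;> omega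
        · rcases Nat.lt_trichotomy (j + 1 + i) (t - 1) with h | h | h
          · have a1 : s i = j + 1 + i := if_pos (by omega)
            have a2 : s (i + 1) = j + 1 + i + 1 := if_pos (by omega)
            rw [a1, a2]
            exact hn _ (by omega)
          · have a1 : s i = t - 1 := (if_pos (by omega)).trans h
            have a2 : s (i + 1) = 0 := (if_neg (by omega)).trans (by omega)
            rw [a1, a2]
            exact hlast
          · have a1 : s i = j + 1 + i - t := if_neg (by omega)
            have a2 : s (i + 1) = j + 1 + i - t + 1 := (if_neg (by omega)).trans (by omega)
            rw [a1, a2]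
            exact hn _ (by omega)
        · refine hjZ _ (hst i (by omega)) ?_
          simp only [hs]; split_ifs <;> omega)
    have heq : {x | ∃ i ≤ t - 1, x ∈ (e (s i) : Set α) \ Z} = {x | ∃ i < t, x ∈ e i} \ Z := by
      ext x
      constructor
      · rintro ⟨i, hi, hx, hxZ⟩
        exact ⟨⟨s i, hst i hi, hx⟩, hxZ⟩
      · rintro ⟨⟨i, hi, hx⟩, hxZ⟩
        refine ⟨if j + 1 ≤ i then i - (j + 1) else i + t - (j + 1), by split_ifs <;> omega, ?_, hxZ⟩
        have : s (if j + 1 ≤ i then i - (j + 1) else i + t - (j + 1)) = i := by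
          simp only [hs]; split_ifs <;> omega
        rw [this]
        exact hx
    rwa [heq] at this
  refine ⟨(hcard 0 (by omega)).trans (Set.encard_le_encard fun x hx => ⟨0, by omega, hx⟩), ?_, ?_⟩
  · have := key ∅ (fun i hi => by simpa using (h2 i hi).2.1) ⟨0, by omega, by simp⟩
    simpa using this
  · intro x _
    refine key {x} (fun i hi => ?_) ?_
    · by_cases hx : x ∈ (e i : Set α)
      · exact (h2 i hi).2.2 x hx
      · rw [Set.sdiff_singleton_eq_self hx]
        exact (h2 i hi).2.1
    · by_cases hx : ∃ j < t, v j = x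
      · obtain ⟨j, hj, rfl⟩ := hx
        exact ⟨j, hj, fun p hp hpj h => hpj (hv p hp j hj h)⟩
      · push Not at hx
        exact ⟨0, by omega, fun p hp _ h => hx p hp h⟩

/-- A maximal 2-connected set of vertices. -/
def IsBlock (E : Finset (Finset α)) (V B : Finset α) : Prop :=
  B ⊆ V ∧ TwoConn (EdgeAdj E) B ∧
    ∀ C : Finset α, C ⊆ V → TwoConn (EdgeAdj E) C → B ⊆ C → C ⊆ B

variable {V : Finset α}

theorem exists_isBlock {X : Set α} (hX : X ⊆ V) (h : TwoConn (EdgeAdj E) X) :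
    ∃ B, IsBlock E V B ∧ X ⊆ B := by
  classical
  obtain ⟨X, rfl⟩ := (V.finite_toSet.subset hX).exists_finset_coe
  obtain ⟨B, hB, hmax⟩ := exists_max_image
    (V.powerset.filter fun C => X ⊆ C ∧ TwoConn (EdgeAdj E) (C : Set α)) Finset.card
    ⟨X, mem_filter.2 ⟨mem_powerset.2 (coe_subset.1 hX), subset_rfl, h⟩⟩
  obtain ⟨hBV, hXB, hB2⟩ := mem_filter.1 hB
  refine ⟨B, ⟨mem_powerset.1 hBV, hB2, fun C hC hC2 hBC => ?_⟩, coe_subset.2 hXB⟩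
  exact (eq_of_subset_of_card_le hBC
    (hmax C (mem_filter.2 ⟨mem_powerset.2 hC, hXB.trans hBC, hC2⟩))).ge

variable [DecidableEq α]

theorem IsBlock.eq_of_two_mem {B C : Finset α} (hB : IsBlock E V B) (hC : IsBlock E V C) {x y : α}
    (hxy : x ≠ y) (hx : x ∈ B ∩ C) (hy : y ∈ B ∩ C) : B = C := by
  have h : TwoConn (EdgeAdj E) ((B ∪ C : Finset α) : Set α) := by
    rw [coe_union]
    exact hB.2.1.union hC.2.1 hxy (by simpa using hx) (by simpa using hy)
  have hV := union_subset hB.1 hC.1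
  exact Subset.antisymm (subset_union_left.trans (hC.2.2 _ hV h subset_union_right))
    (subset_union_right.trans (hB.2.2 _ hV h subset_union_left))

/-- All hyperedges of a Berge cycle lie in one block, because their union is 2-connected; a block
has only `r - 1` of them. -/
theorem cycleFree_of_blocks (hr : 2 < r) (hu : ∀ f ∈ E, f.card = r) (hV : ∀ f ∈ E, f ⊆ V)
    (hB : ∀ B, IsBlock E V B → (E.filter (· ⊆ B)).card = r - 1) : CycleFree E r := by
  intro t ht e v he hei hv hl hn hlast
  obtain ⟨B, hBB, hsub⟩ := exists_isBlock (V := V) (X := {x | ∃ i < t, x ∈ e i})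
    (fun x ⟨i, hi, hx⟩ => hV _ (he i hi) hx)
    (twoConn_cycle hr hu (by omega) he hv hl hn hlast)
  have h1 : (range t).image e ⊆ E.filter (· ⊆ B) := by
    intro f hf
    obtain ⟨i, hi, rfl⟩ := mem_image.1 hf
    have hi := mem_range.1 hi
    exact mem_filter.2 ⟨he i hi, fun x hx => hsub ⟨i, hi, hx⟩⟩
  have h2 := card_le_card h1
  rw [card_image_of_injOn, card_range, hB B hBB] at h2
  · omega
  · intro i hi j hj hij
    exact hei i (mem_range.1 hi) j (mem_range.1 hj) hij

/-- Distinct blocks share at most one vertex, so no hyperedge is counted twice. Starting from a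
vertex and adding blocks that meet the current set, each block brings at most `r` new vertices,
which bounds the number of blocks from below. -/
theorem le_card_of_blocks (hr : 2 < r) (hu : ∀ f ∈ E, f.card = r) (hV : ∀ f ∈ E, f ⊆ V)
    (hc : Conn (EdgeAdj E) V) (hBc : ∀ B, IsBlock E V B → B.card = r + 1)
    (hB : ∀ B, IsBlock E V B → (E.filter (· ⊆ B)).card = r - 1) :
    (V.card - 1) / r * (r - 1) ≤ E.card := by
  classical
  set 𝓑 := V.powerset.filter (IsBlock E V) with h𝓑
  have hm : ∀ B, B ∈ 𝓑 ↔ IsBlock E V B := fun B =>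
    ⟨fun h => (mem_filter.1 h).2, fun h => mem_filter.2 ⟨mem_powerset.2 h.1, h⟩⟩
  have hedges : 𝓑.card * (r - 1) ≤ E.card := by
    have h1 : (𝓑.biUnion fun B => E.filter (· ⊆ B)).card = 𝓑.card * (r - 1) := by
      rw [card_biUnion, sum_congr rfl fun B hBB => hB B ((hm B).1 hBB), sum_const, smul_eq_mul]
      intro B hBB C hCC hne
      rw [Function.onFun, disjoint_left]
      intro f hf hf'
      obtain ⟨hf, hfB⟩ := mem_filter.1 hf
      obtain ⟨-, hfC⟩ := mem_filter.1 hf'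
      obtain ⟨x, hx, y, hy, hxy⟩ := one_lt_card.1 (show 1 < f.card by rw [hu f hf]; omega)
      exact hne (((hm B).1 hBB).eq_of_two_mem ((hm C).1 hCC) hxy
        (mem_inter.2 ⟨hfB hx, hfC hx⟩) (mem_inter.2 ⟨hfB hy, hfC hy⟩))
    rw [← h1]
    exact card_le_card (biUnion_subset.2 fun B _ => filter_subset _ _)
  have hgrow : V.card ≤ 1 + 𝓑.card * r := by
    obtain ⟨x₀, hx₀⟩ := hc.1
    -- A largest family obeying the estimate covers `V`: otherwise a hyperedge leaves the covered
    -- set, and the block containing it could be added.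
    obtain ⟨𝓒, h𝓒, hmax⟩ := exists_max_image (𝓑.powerset.filter fun 𝓒 =>
      (insert x₀ (𝓒.biUnion id)).card ≤ 1 + 𝓒.card * r) Finset.card ⟨∅, by simp⟩
    obtain ⟨h𝓒𝓑, h𝓒c⟩ := mem_filter.1 h𝓒
    have h𝓒𝓑 := mem_powerset.1 h𝓒𝓑
    set X := insert x₀ (𝓒.biUnion id) with hX
    have hXV : X ⊆ V := insert_subset hx₀ (biUnion_subset.2 fun B hB' =>
      ((hm B).1 (h𝓒𝓑 hB')).1)
    have hXeq : X = V := by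
      by_contra hne
      obtain ⟨b, hb, hbX⟩ := exists_of_ssubset (hXV.ssubset_of_ne hne)
      obtain ⟨a, ha, b, hb, f, hf, haf, hbf⟩ := hc.2 X (coe_subset.2 hXV) ⟨x₀, by simp [hX]⟩
        ⟨b, hb, hbX⟩
      have h3 : 3 ≤ (f : Set α).encard := by
        rw [Set.encard_coe_eq_coe_finsetCard, hu _ hf]
        exact_mod_cast hr
      obtain ⟨B, hBB, hfB⟩ := exists_isBlock (coe_subset.2 (hV f hf))
        (twoConn_of_clique h3 (edgeAdj_clique hf))
      have hB𝓒 : B ∉ 𝓒 := fun h =>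
        hb.2 (mem_coe.2 (mem_insert_of_mem (mem_biUnion.2 ⟨B, h, hfB hbf⟩)))
      have hins : insert x₀ ((insert B 𝓒).biUnion id) = X ∪ B := by
        ext z
        simp only [hX, biUnion_insert, id, mem_insert, mem_union]
        tauto
      have hcu := card_union_add_card_inter X B
      have hpos : 0 < (X ∩ B).card := card_pos.2 ⟨a, mem_inter.2 ⟨ha, hfB haf⟩⟩
      have hBr := hBc B hBB
      have hle := hmax (insert B 𝓒) (mem_filter.2 ⟨mem_powerset.2
        (insert_subset ((hm B).2 hBB) h𝓒𝓑), by
          rw [hins, card_insert_of_notMem hB𝓒, Nat.succ_mul]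
          omega⟩)
      rw [card_insert_of_notMem hB𝓒] at hle
      omega
    rw [← hXeq]
    exact h𝓒c.trans (Nat.add_le_add_left (Nat.mul_le_mul_right r (card_le_card h𝓒𝓑)) 1)
  refine le_trans (Nat.mul_le_mul_right _ ?_) hedges
  refine Nat.div_le_of_le_mul ?_
  rw [mul_comm]
  omega

/-- The set `C` supplied by `block` is itself 2-connected, as the union of two hyperedges sharing `r
- 1 ≥ 2` vertices, so the maximality of `B` gives `B = C`. -/
theorem TreeLike.block_spec (hr : 2 < r) (hu : ∀ f ∈ E, f.card = r) (h : TreeLike E V r)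
    {B : Finset α} (hB : IsBlock E V B) :
    B.card = r + 1 ∧ (E.filter (· ⊆ B)).card = r - 1 := by
  obtain ⟨C, hBC, hCV, hCc, hCe⟩ := h.block B (coe_subset.2 hB.1) hB.2.1
  have hC2 : TwoConn (EdgeAdj E) (C : Set α) := by
    obtain ⟨f, hf, g, hg, hfg⟩ := one_lt_card.1 (show 1 < (E.filter (· ⊆ C)).card by omega)
    obtain ⟨hf, hfC⟩ := mem_filter.1 hf
    obtain ⟨hg, hgC⟩ := mem_filter.1 hg
    have hfgC := union_eq_of_card hfC hgC hfg (hu f hf) (hu g hg) hCc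
    have h1 := card_union_add_card_inter f g
    rw [hfgC, hCc, hu f hf, hu g hg] at h1
    obtain ⟨x, hx, y, hy, hxy⟩ := one_lt_card.1 (show 1 < (f ∩ g).card by omega)
    have h3 : ∀ f ∈ E, 3 ≤ (f : Set α).encard := fun f hf => by
      rw [Set.encard_coe_eq_coe_finsetCard, hu _ hf]
      exact_mod_cast hr
    rw [← hfgC, coe_union]
    exact (twoConn_of_clique (h3 f hf) (edgeAdj_clique hf)).union
      (twoConn_of_clique (h3 g hg) (edgeAdj_clique hg)) hxy (by simpa using hx) (by simpa using hy)
  obtain rfl : B = C := Subset.antisymm (coe_subset.1 hBC) (hB.2.2 C hCV hC2 (coe_subset.1 hBC))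
  exact ⟨hCc, hCe⟩

end Blocks

/-! ### Translation between `Hypergraph` and finite set families -/

section Bridge

open Finset

/-- `E` and `V` are the finite sets of hyperedges and vertices of `H`. -/
structure Rep {α : Type*} (H : Hypergraph α) (E : Finset (Finset α)) (V : Finset α) : Prop where
  vert : V(H) = V
  edge : ∀ s : Set α, s ∈ E(H) ↔ ∃ f ∈ E, (f : Set α) = s

variable {α : Type*} {H : Hypergraph α} {E : Finset (Finset α)} {V : Finset α} {r k n : ℕ}

theorem exists_rep (h : V(H).encard = n) : ∃ E V, Rep H E V := by
  have hfin : V(H).Finite := Set.finite_of_encard_eq_coe h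
  have hE : {f : Finset α | (f : Set α) ∈ E(H)}.Finite :=
    Set.Finite.subset (hfin.toFinset.powerset : Finset (Finset α)).finite_toSet fun f hf => by
      simp only [coe_powerset, Set.mem_preimage, Set.mem_powerset_iff, Set.Finite.coe_toFinset]
      exact H.subset_vertexSet_of_mem_edgeSet hf
  refine ⟨hE.toFinset, hfin.toFinset, by simp, fun s => ⟨fun hs => ?_, ?_⟩⟩
  · obtain ⟨f, rfl⟩ := (hfin.subset (H.subset_vertexSet_of_mem_edgeSet hs)).exists_finset_coe
    exact ⟨f, by simpa using hs, rfl⟩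
  · rintro ⟨f, hf, rfl⟩
    simpa using hf

namespace Rep

theorem mem_iff (h : Rep H E V) {f : Finset α} : (f : Set α) ∈ E(H) ↔ f ∈ E := by
  rw [h.edge]
  exact ⟨fun ⟨g, hg, hgf⟩ => coe_injective hgf ▸ hg, fun hf => ⟨f, hf, rfl⟩⟩

theorem subset (h : Rep H E V) : ∀ f ∈ E, f ⊆ V := fun f hf => by
  have := H.subset_vertexSet_of_mem_edgeSet (h.mem_iff.2 hf)
  rwa [h.vert, coe_subset] at this

theorem encard_eq (h : Rep H E V) : V(H).encard = n ↔ V.card = n := by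
  rw [h.vert, Set.encard_coe_eq_coe_finsetCard]
  exact Nat.cast_inj

theorem isUniform_iff (h : Rep H E V) : IsUniform H r ↔ ∀ f ∈ E, f.card = r := by
  constructor
  · intro hu f hf
    have := hu _ (h.mem_iff.2 hf)
    rw [Set.encard_coe_eq_coe_finsetCard] at this
    exact_mod_cast this
  · intro hu s hs
    obtain ⟨f, hf, rfl⟩ := (h.edge s).1 hs
    rw [Set.encard_coe_eq_coe_finsetCard, hu f hf]

theorem edgeSet_eq (h : Rep H E V) : E(H) = (fun f : Finset α => (f : Set α)) '' (E : Set _) := by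
  ext s
  rw [h.edge]
  rfl

theorem ncard_edgeSet (h : Rep H E V) : E(H).ncard = E.card := by
  rw [h.edgeSet_eq, Set.ncard_image_of_injective _ coe_injective, Set.ncard_coe_finset]

theorem adj_iff (h : Rep H E V) {x y : α} : H.Adj x y ↔ EdgeAdj E x y := by
  constructor
  · rintro ⟨s, hs, hx, hy⟩
    obtain ⟨f, hf, rfl⟩ := (h.edge s).1 hs
    exact ⟨f, hf, hx, hy⟩
  · rintro ⟨f, hf, hx, hy⟩
    exact ⟨f, h.mem_iff.2 hf, hx, hy⟩

/-- Only the indexing differs: `v i` lies in `e i` and `e (i + 1)` in `CycleFree`, but in `e (i -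
1)` and `e i` in `HasBergeCycle`, so the vertices are shifted cyclically by one. -/
theorem bergeCycleFree_iff (h : Rep H E V) (hk : 2 ≤ k) :
    BergeCycleFree H k ↔ CycleFree E k := by
  constructor
  · intro hH t ht e v he hei hvi hl hn hlast
    refine hH t ht ⟨hk.trans ht, fun i => v (if (i : ℕ) = 0 then t - 1 else i - 1),
      fun i => (e i : Set α), ?_, ?_, ?_⟩
    · intro i j hij
      have := hvi _ (by split_ifs <;> omega) _ (by split_ifs <;> omega) hij
      ext
      split_ifs at this <;> omega
    · intro i j hij
      ext
      exact hei i i.2 j j.2 (coe_injective hij)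
    · obtain ⟨t, rfl⟩ := Nat.exists_eq_succ_of_ne_zero (show t ≠ 0 by omega)
      intro i
      refine ⟨h.mem_iff.2 (he i i.2), ?_, ?_⟩
      · beta_reduce
        split_ifs with h0
        · rw [h0]
          exact hlast
        · have := hn (i - 1) (by omega)
          rwa [show (i : ℕ) - 1 + 1 = i by omega] at this
      · beta_reduce
        rw [coe_finRotate]
        have h1 := hl i i.2
        by_cases h0 : i = Fin.last t
        · rw [if_pos h0, if_pos rfl]
          simpa [h0] using h1
        · rw [if_neg h0, if_neg (Nat.succ_ne_zero _)]
          simpa using h1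
  · rintro hE t ht ⟨ht2, v, e, hvi, hei, hve⟩
    obtain ⟨t, rfl⟩ := Nat.exists_eq_succ_of_ne_zero (show t ≠ 0 by omega)
    choose F hF hFe using fun i => (h.edge (e i)).1 (hve i).1
    have hvF : ∀ i, v i ∈ F i := fun i => by
      have := (hve i).2.1
      rwa [← hFe i] at this
    have hvF' : ∀ i, v (finRotate _ i) ∈ F i := fun i => by
      have := (hve i).2.2
      rwa [← hFe i] at this
    refine hE (t + 1) ht (fun i => if hi : i < t + 1 then F ⟨i, hi⟩ else ∅)
      (fun i => if hi : i < t + 1 then v (finRotate _ ⟨i, hi⟩) else v 0) ?_ ?_ ?_ ?_ ?_ ?_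
    · intro i hi
      simpa only [hi, dif_pos] using hF _
    · intro i hi j hj hij
      simp only [hi, hj, dif_pos] at hij
      simpa using hei ((hFe _).symm.trans ((congrArg _ hij).trans (hFe _)))
    · intro i hi j hj hij
      simp only [hi, hj, dif_pos] at hij
      simpa using (finRotate _).injective (hvi hij)
    · intro i hi
      simpa only [hi, dif_pos] using hvF' _
    · intro i hi
      simp only [hi, show i < t + 1 by omega, dif_pos]
      rw [finRotate_of_lt (by omega)]
      exact hvF _
    · simp only [show t + 1 - 1 < t + 1 by omega, show 0 < t + 1 by omega, dif_pos]
      have : finRotate (t + 1) ⟨t + 1 - 1, by omega⟩ = ⟨0, by omega⟩ := finRotate_last'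
      rw [this]
      exact hvF _

theorem shadow_connected_iff (h : Rep H E V) : (shadow H).Connected ↔ Conn (EdgeAdj E) V := by
  rw [connected_iff_conn (R := EdgeAdj E) (fun x : V(H) => (x : α)) Subtype.val_injective,
    Subtype.range_coe, h.vert]
  intro a b
  rw [← h.adj_iff]
  rfl

theorem isTwoConnected_iff (h : Rep H E V) (B : Set V(H)) :
    IsTwoConnected ((shadow H).induce B) ↔ TwoConn (EdgeAdj E) (Subtype.val '' B) := by
  rw [isTwoConnected_iff_twoConn (R := EdgeAdj E) (fun x : B => ((x : V(H)) : α))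
    (Subtype.val_injective.comp Subtype.val_injective)]
  · have : Set.range (fun x : B => ((x : V(H)) : α)) = Subtype.val '' B := by
      ext y
      simp
    rw [this]
  · intro a b
    rw [← h.adj_iff, SimpleGraph.induce_adj, shadow]
    simp [Subtype.ext_iff]

theorem isBlock_iff (h : Rep H E V) {B : Set V(H)} {C : Finset α}
    (hBC : (C : Set α) = Subtype.val '' B) :
    IsTwoConnectedBlock (shadow H) B ↔ IsBlock E V C := by
  have hsub : ∀ B : Set V(H), Subtype.val '' B ⊆ (V : Set α) := fun B =>
    (Subtype.coe_image_subset _ B).trans h.vert.subset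
  rw [IsTwoConnectedBlock, Maximal, IsBlock, h.isTwoConnected_iff, ← hBC]
  constructor
  · rintro ⟨h1, h2⟩
    refine ⟨coe_subset.1 (hBC ▸ hsub B), h1, fun D hD hD2 hCD => ?_⟩
    have hDim : Subtype.val '' (Subtype.val ⁻¹' (D : Set α) : Set V(H)) = (D : Set α) := by
      rw [Subtype.image_preimage_coe, Set.inter_eq_right, h.vert]
      exact coe_subset.2 hD
    have h3 := h2 (y := Subtype.val ⁻¹' (D : Set α)) (by
      rw [h.isTwoConnected_iff, hDim]
      exact hD2) (by
      intro x hx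
      have : (x : α) ∈ (C : Set α) := by rw [hBC]; exact ⟨x, hx, rfl⟩
      exact hCD this)
    rw [← coe_subset, hBC, ← hDim]
    exact Set.image_mono h3
  · rintro ⟨-, h1, h2⟩
    refine ⟨h1, fun D hD hBD => ?_⟩
    have hD' := (h.isTwoConnected_iff D).1 hD
    obtain ⟨D', hD''⟩ := (V.finite_toSet.subset (hsub D)).exists_finset_coe
    rw [← hD''] at hD'
    have h3 := h2 D' (coe_subset.1 (hD'' ▸ hsub D)) hD' (by
      rw [← coe_subset, hBC, hD'']
      exact Set.image_mono hBD)
    rw [← coe_subset, hBC, hD''] at h3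
    exact (Set.image_subset_image_iff Subtype.val_injective).1 h3

theorem isBlockTree_iff [DecidableEq α] (h : Rep H E V) {s m : ℕ} :
    IsBlockTree H s m ↔ Conn (EdgeAdj E) V ∧
      ∀ B, IsBlock E V B → B.card = s ∧ (E.filter (· ⊆ B)).card = m := by
  have hcard : ∀ (B : Set V(H)) (C : Finset α), (C : Set α) = Subtype.val '' B →
      (B.encard = s ↔ C.card = s) ∧
      ({e ∈ E(H) | e ⊆ Subtype.val '' B}.encard = m ↔ (E.filter (· ⊆ C)).card = m) := by
    intro B C hBC
    constructor
    · rw [← Subtype.val_injective.encard_image, ← hBC, Set.encard_coe_eq_coe_finsetCard]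
      exact Nat.cast_inj
    · have : {e ∈ E(H) | e ⊆ Subtype.val '' B} =
          (fun f : Finset α => (f : Set α)) '' ((E.filter (· ⊆ C) : Finset _) : Set _) := by
        ext e
        constructor
        · rintro ⟨he, heB⟩
          obtain ⟨f, hf, rfl⟩ := (h.edge e).1 he
          exact ⟨f, mem_coe.2 (mem_filter.2 ⟨hf, coe_subset.1 (hBC ▸ heB)⟩), rfl⟩
        · rintro ⟨f, hf, rfl⟩
          obtain ⟨hf, hfC⟩ := mem_filter.1 (mem_coe.1 hf)
          exact ⟨h.mem_iff.2 hf, hBC ▸ coe_subset.2 hfC⟩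
      rw [this, coe_injective.encard_image, Set.encard_coe_eq_coe_finsetCard]
      exact Nat.cast_inj
  rw [IsBlockTree, h.shadow_connected_iff]
  refine and_congr_right fun _ => ⟨fun hB C hC => ?_, fun hB B hB2 => ?_⟩
  · have hCim : (C : Set α) = Subtype.val '' (Subtype.val ⁻¹' (C : Set α) : Set V(H)) := by
      rw [Subtype.image_preimage_coe, eq_comm, Set.inter_eq_right, h.vert]
      exact coe_subset.2 hC.1
    obtain ⟨h1, h2⟩ := hB _ ((h.isBlock_iff hCim).2 hC)
    exact ⟨(hcard _ _ hCim).1.1 h1, (hcard _ _ hCim).2.1 h2⟩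
  · have hsub : Subtype.val '' B ⊆ (V : Set α) :=
      (Subtype.coe_image_subset _ B).trans h.vert.subset
    obtain ⟨C, hC⟩ := (V.finite_toSet.subset hsub).exists_finset_coe
    obtain ⟨h1, h2⟩ := hB C ((h.isBlock_iff hC).1 hB2)
    exact ⟨(hcard _ _ hC).1.2 h1, (hcard _ _ hC).2.2 h2⟩

end Rep

end Bridge

/-! ### Lower bounds: stars and block trees -/

section Constructions

open Finset

/-- Distinct hyperedges meet only inside the core, so a cycle has all its vertices there, at most `r
- 1` of them. -/
theorem cycleFree_of_core {α : Type*} {E : Finset (Finset α)} {r : ℕ} (hr : 2 < r)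
    (hu : ∀ f ∈ E, f.card = r) {K : Finset α} (hK : K.card = r - 1) (hKE : ∀ f ∈ E, K ⊆ f) :
    CycleFree E r := by
  classical
  intro t ht e v he hei hvi hl hn hlast
  have key : ∀ f ∈ E, ∀ g ∈ E, f ≠ g → ∀ x ∈ f, x ∈ g → x ∈ K := by
    intro f hf g hg hfg x hxf hxg
    by_contra hx
    have : ∀ h ∈ E, x ∈ h → insert x K = h := fun h hh hxh =>
      eq_of_subset_of_card_le (insert_subset hxh (hKE h hh)) (by
        rw [card_insert_of_notMem hx, hK, hu h hh]
        omega)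
    exact hfg ((this f hf hxf).symm.trans (this g hg hxg))
  have hsub : (range t).image v ⊆ K := by
    intro x hx
    obtain ⟨i, hi, rfl⟩ := mem_image.1 hx
    have hi := mem_range.1 hi
    rcases Nat.lt_or_ge (i + 1) t with h | h
    · refine key _ (he i hi) _ (he (i + 1) h) (fun h' => ?_) _ (hl i hi) (hn i h)
      have := hei i hi _ h h'
      omega
    · obtain rfl : i = t - 1 := by omega
      refine key _ (he _ hi) _ (he 0 (by omega)) (fun h' => ?_) _ (hl _ hi) hlast
      have := hei _ hi 0 (by omega) h'
      omega
  have := card_le_card hsub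
  rw [card_image_of_injOn, card_range] at this
  · omega
  · intro i hi j hj hij
    exact hvi i (mem_range.1 hi) j (mem_range.1 hj) hij

/-- The hypergraph with given finite set of hyperedges and all vertices of a type. -/
def ofFinset {α : Type*} (E : Finset (Finset α)) : Hypergraph α where
  vertexSet := Set.univ
  edgeSet := (fun f : Finset α => (f : Set α)) '' (E : Set (Finset α))
  subset_vertexSet_of_mem_edgeSet' := fun e _ => Set.subset_univ e

theorem rep_ofFinset {α : Type*} [Fintype α] (E : Finset (Finset α)) :
    Rep (ofFinset E) E univ :=
  ⟨by simp [ofFinset], fun _ => Iff.rfl⟩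

theorem mem_edgeNumbers {n r : ℕ} (hr : 2 < r) {E : Finset (Finset (Fin n))}
    (hu : ∀ f ∈ E, f.card = r) (hE : CycleFree E r) : E.card ∈ edgeNumbers n r r :=
  have h := rep_ofFinset E
  ⟨ofFinset E, rfl, h.isUniform_iff.2 hu, (h.bergeCycleFree_iff (by omega)).2 hE, h.ncard_edgeSet⟩

/-- Stars attain the linear bound. -/
theorem star_card_mem {n r : ℕ} (hr : 2 < r) (hn : r ≤ n) : n + 1 - r ∈ edgeNumbers n r r := by
  set K : Finset (Fin n) := univ.filter fun i => (i : ℕ) < r - 1 with hK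
  have hKc : K.card = r - 1 := by
    rw [Fin.card_filter_val_lt]
    omega
  have hKc' : Kᶜ.card = n + 1 - r := by
    rw [card_compl, hKc, Fintype.card_fin]
    omega
  have hinj : Set.InjOn (fun i => insert i K) (Kᶜ : Finset (Fin n)) := by
    intro i hi j hj hij
    have : i ∈ insert j K := by
      have := mem_insert_self i K
      rwa [show insert i K = insert j K from hij] at this
    exact (mem_insert.1 this).resolve_right (mem_compl.1 hi)
  have hu : ∀ f ∈ Kᶜ.image (fun i => insert i K), f.card = r := by
    intro f hf
    obtain ⟨i, hi, rfl⟩ := mem_image.1 hf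
    rw [card_insert_of_notMem (mem_compl.1 hi), hKc]
    omega
  have := mem_edgeNumbers hr hu (cycleFree_of_core hr hu hKc fun f hf => by
    obtain ⟨i, -, rfl⟩ := mem_image.1 hf
    exact subset_insert _ _)
  rwa [card_image_of_injOn hinj, hKc'] at this

/-- The `c`-th hyperedge of the `a`-th block of a block tree in which all blocks share a vertex. -/
def petal (n r a c : ℕ) : Finset (Fin n) :=
  univ.filter fun x => (x : ℕ) = 0 ∨ (a * r + 1 ≤ x ∧ (x : ℕ) ≤ a * r + r ∧ (x : ℕ) ≠ a * r + 1 + c)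

theorem card_petal {n r a c : ℕ} (h : a * r + r < n) (hc : c < r) : (petal n r a c).card = r := by
  have : (petal n r a c).image (fun x : Fin n => (x : ℕ)) =
      insert 0 ((Icc (a * r + 1) (a * r + r)).erase (a * r + 1 + c)) := by
    ext x
    simp only [petal, mem_image, mem_filter, mem_univ, true_and, mem_insert, mem_erase, mem_Icc]
    constructor
    · rintro ⟨y, hy, rfl⟩
      omega
    · intro hx
      exact ⟨⟨x, by omega⟩, by dsimp only; omega, rfl⟩
  rw [← card_image_of_injective _ Fin.val_injective, this, card_insert_of_notMem (by simp),
    card_erase_of_mem (mem_Icc.2 ⟨by omega, by omega⟩), Nat.card_Icc]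
  omega

theorem petal_index {n r a c b d : ℕ} {x : Fin n} (hx : x ∈ petal n r a c) (hx' : x ∈ petal n r b d)
    (h0 : (x : ℕ) ≠ 0) : a = b := by
  simp only [petal, mem_filter, mem_univ, true_and] at hx hx'
  have h1 := hx.resolve_left h0
  have h2 := hx'.resolve_left h0
  rcases Nat.lt_trichotomy a b with h | h | h
  · have := Nat.mul_le_mul_right r (Nat.succ_le_of_lt h)
    rw [Nat.succ_mul] at this
    omega
  · exact h
  · have := Nat.mul_le_mul_right r (Nat.succ_le_of_lt h)
    rw [Nat.succ_mul] at this
    omega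

theorem petal_mem {n r a c y : ℕ} (h : y < n) (h1 : a * r + 1 ≤ y) (h2 : y ≤ a * r + r) :
    (⟨y, h⟩ : Fin n) ∈ petal n r a c ↔ y ≠ a * r + 1 + c := by
  simp only [petal, mem_filter, mem_univ, true_and]
  omega

theorem petal_inj {n r a c b d : ℕ} (hr : 2 < r) (h : a * r + r < n)
    (hd : d < r) (heq : petal n r a c = petal n r b d) : a = b ∧ c = d := by
  obtain rfl : a = b := by
    have h1 : (⟨a * r + 1 + if c = 0 then 1 else 0, by split_ifs <;> omega⟩ : Fin n) ∈
        petal n r a c := (petal_mem _ (by omega) (by split_ifs <;> omega)).2 (by split_ifs <;> omega)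
    exact petal_index h1 (heq ▸ h1) (by simp)
  refine ⟨rfl, ?_⟩
  by_contra hne
  have h1 : (⟨a * r + 1 + d, by omega⟩ : Fin n) ∈ petal n r a c :=
    (petal_mem _ (by omega) (by omega)).2 (by omega)
  rw [heq, petal_mem _ (by omega) (by omega)] at h1
  exact h1 rfl

/-- Block trees attain the bound. -/
theorem petals_card_mem {n r : ℕ} (hr : 2 < r) :
    (n - 1) / r * (r - 1) ∈ edgeNumbers n r r := by
  set q := (n - 1) / r with hq
  have hqn : ∀ a < q, a * r + r < n := by
    intro a ha
    have h1 := Nat.mul_le_mul_right r (Nat.succ_le_of_lt ha)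
    have h2 := Nat.div_mul_le_self (n - 1) r
    rw [Nat.succ_mul] at h1
    rw [← hq] at h2
    omega
  set E := (range q ×ˢ range (r - 1)).image fun p => petal n r p.1 p.2 with hE
  have hmem : ∀ f, f ∈ E ↔ ∃ a < q, ∃ c < r - 1, petal n r a c = f := by
    intro f
    simp only [hE, mem_image, mem_product, mem_range, Prod.exists]
    constructor
    · rintro ⟨a, c, ⟨ha, hc⟩, h⟩
      exact ⟨a, ha, c, hc, h⟩
    · rintro ⟨a, ha, c, hc, h⟩
      exact ⟨a, c, ⟨ha, hc⟩, h⟩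
  have hu : ∀ f ∈ E, f.card = r := by
    intro f hf
    obtain ⟨a, ha, c, hc, rfl⟩ := (hmem f).1 hf
    exact card_petal (hqn a ha) (by omega)
  have hcard : E.card = q * (r - 1) := by
    rw [hE, card_image_of_injOn, card_product, card_range, card_range]
    rintro ⟨a, c⟩ h1 ⟨b, d⟩ h2 h
    simp only [coe_product, coe_range, Set.mem_prod, Set.mem_Iio] at h1 h2
    obtain ⟨rfl, rfl⟩ := petal_inj hr (hqn a h1.1) (by omega) h
    rfl
  have hfree : CycleFree E r := by
    intro t ht e v he hei hvi hl hn hlast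
    have : ∀ i, ∃ a c, i < t → c < r - 1 ∧ petal n r a c = e i := fun i => by
      by_cases hi : i < t
      · obtain ⟨a, ha, c, hc, h⟩ := (hmem _).1 (he i hi)
        exact ⟨a, c, fun _ => ⟨hc, h⟩⟩
      · exact ⟨0, 0, fun h => absurd h hi⟩
    choose a c hac using this
    have hstep : ∀ i j k, j < t → k < t → (v i : ℕ) ≠ 0 → v i ∈ e j → v i ∈ e k → a j = a k := by
      intro i j k hj hk h0 h1 h2
      rw [← (hac j hj).2] at h1
      rw [← (hac k hk).2] at h2
      exact petal_index h1 h2 h0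
    -- At most one cycle vertex is the common vertex `0`. Any other link keeps the block index, so
    -- going both ways around from `e 0` to the link `v j` stays in one block.
    obtain ⟨j, hj, hj0⟩ : ∃ j < t, ∀ p < t, p ≠ j → (v p : ℕ) ≠ 0 := by
      by_cases hex : ∃ j < t, (v j : ℕ) = 0
      · obtain ⟨j, hj, h⟩ := hex
        exact ⟨j, hj, fun p hp hpj h' => hpj (hvi p hp j hj (Fin.ext (h'.trans h.symm)))⟩
      · push Not at hex
        exact ⟨0, by omega, fun p hp _ => hex p hp⟩
    have hlow : ∀ i ≤ j, a i = a 0 := by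
      intro i
      induction i with
      | zero => intro _; rfl
      | succ i ih =>
        intro hi
        rw [← ih (by omega)]
        exact (hstep i i (i + 1) (by omega) (by omega) (hj0 i (by omega) (by omega))
          (hl i (by omega)) (hn i (by omega))).symm
    have hhigh : ∀ k, j + k + 1 < t → a (t - 1 - k) = a 0 := by
      intro k
      induction k with
      | zero =>
        intro hk
        exact hstep (t - 1) _ _ (by omega) (by omega) (hj0 _ (by omega) (by omega))
          (hl _ (by omega)) hlast
      | succ k ih =>
        intro hk
        rw [← ih (by omega)]
        have h1 := hn (t - 1 - (k + 1)) (by omega)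
        rw [show t - 1 - (k + 1) + 1 = t - 1 - k by omega] at h1
        exact hstep (t - 1 - (k + 1)) _ _ (by omega) (by omega) (hj0 _ (by omega) (by omega))
          (hl _ (by omega)) h1
    have hall : ∀ i < t, a i = a 0 := by
      intro i hi
      rcases Nat.lt_or_ge j i with h | h
      · have := hhigh (t - 1 - i) (by omega)
        rwa [show t - 1 - (t - 1 - i) = i by omega] at this
      · exact hlow i h
    have hsub : (range t).image c ⊆ range (r - 1) := by
      intro x hx
      obtain ⟨i, hi, rfl⟩ := mem_image.1 hx
      exact mem_range.2 (hac i (mem_range.1 hi)).1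
    have := card_le_card hsub
    rw [card_image_of_injOn, card_range, card_range] at this
    · omega
    · intro i hi k hk hik
      have hi := mem_range.1 hi
      have hk := mem_range.1 hk
      refine hei i hi k hk ?_
      rw [← (hac i hi).2, ← (hac k hk).2, hall i hi, hall k hk, show c i = c k from hik]
  rw [← hcard]
  exact mem_edgeNumbers hr hu hfree

theorem exBerge_eq_bound {n r : ℕ} (hr : 2 < r) : exBerge n r r = bound r n := by
  obtain ⟨hmem, hmax⟩ := exBerge_isGreatest n r r
  apply le_antisymm
  · obtain ⟨H, hV, hu, hf, hc⟩ := hmem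
    obtain ⟨E, V, h⟩ := exists_rep (H := H) (n := n) (by rw [hV]; simp)
    have hVc : V.card = n := h.encard_eq.1 (by rw [hV]; simp)
    have hle := card_le_bound hr (h.isUniform_iff.1 hu) ((h.bergeCycleFree_iff (by omega)).1 hf)
      h.subset
    rwa [hVc, ← h.ncard_edgeSet, hc] at hle
  · refine max_le (hmax (petals_card_mem hr)) ?_
    rcases Nat.lt_or_ge n r with hlt | hge
    · omega
    · exact hmax (star_card_mem hr hge)

end Constructions

/-! ### Isomorphism with the star -/

section Star

open Finset

variable {α : Type*} {H : Hypergraph α} {n r : ℕ}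

theorem star_mem_iff {s : Set (Fin n)} : s ∈ E(star n r) ↔
    ∃ i : Fin n, r - 1 ≤ (i : ℕ) ∧ s = insert i {j : Fin n | (j : ℕ) < r - 1} := Iff.rfl

theorem encard_starCore (hn : r ≤ n) (hr : 2 < r) :
    {j : Fin n | (j : ℕ) < r - 1}.encard = (r - 1 : ℕ) := by
  have : {j : Fin n | (j : ℕ) < r - 1} =
      ((univ.filter fun j : Fin n => (j : ℕ) < r - 1 : Finset (Fin n)) : Set (Fin n)) := by
    ext j
    simp
  rw [this, Set.encard_coe_eq_coe_finsetCard, Fin.card_filter_val_lt, min_eq_right (by omega)]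

theorem encard_star_edge (hn : r ≤ n) (hr : 2 < r) {s : Set (Fin n)} (hs : s ∈ E(star n r)) :
    s.encard = r := by
  obtain ⟨i, hi, rfl⟩ := star_mem_iff.1 hs
  rw [Set.encard_insert_of_notMem (by simpa using hi), encard_starCore hn hr]
  exact_mod_cast Nat.sub_add_cancel (show 1 ≤ r by omega)

theorem ncard_star (hn : r ≤ n) (hr : 2 < r) : E(star n r).ncard = n + 1 - r := by
  have h1 : E(star n r) = (fun i => insert i {j : Fin n | (j : ℕ) < r - 1}) ''
      {j : Fin n | (j : ℕ) < r - 1}ᶜ := by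
    ext s
    rw [star_mem_iff]
    constructor
    · rintro ⟨i, hi, rfl⟩
      exact ⟨i, by simpa using hi, rfl⟩
    · rintro ⟨i, hi, rfl⟩
      exact ⟨i, by simpa using hi, rfl⟩
  rw [h1, Set.InjOn.ncard_image]
  · have h2 := Set.ncard_add_ncard_compl {j : Fin n | (j : ℕ) < r - 1}
    have h3 : {j : Fin n | (j : ℕ) < r - 1}.ncard = r - 1 := by
      rw [Set.ncard, encard_starCore hn hr, ENat.toNat_natCast]
    rw [h3, Nat.card_eq_fintype_card, Fintype.card_fin] at h2
    omega
  · intro i hi j hj hij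
    have : i ∈ insert j {j : Fin n | (j : ℕ) < r - 1} := by
      rw [← show insert i _ = insert j _ from hij]
      exact Set.mem_insert i _
    exact this.resolve_right hi

theorem isExtremal_of_isIsomorphic_star (hr : 2 < r) (hn : r ≤ n)
    (hb : exBerge n r r = n + 1 - r) (h : IsIsomorphic H (star n r)) : IsExtremal H n r r := by
  obtain ⟨φ, hφ⟩ := h
  have hV : V(H).encard = n := by
    have h1 : V(H).encard = V(star n r).encard := ENat.card_congr φ
    have h2 : V(star n r) = Set.univ := rfl
    rw [h1, h2, Set.encard_univ]
    simp
  have hpre : ∀ s ∈ E(H), ∃ S : Set V(H), Subtype.val '' S = s := fun s hs =>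
    ⟨Subtype.val ⁻¹' s, by
      rw [Subtype.image_preimage_coe, Set.inter_eq_right]
      exact H.subset_vertexSet_of_mem_edgeSet hs⟩
  have hinj : Function.Injective fun S : Set V(H) => (Subtype.val '' (φ '' S) : Set (Fin n)) :=
    fun S T hST => Set.image_injective.2 φ.injective
      (Set.image_injective.2 Subtype.val_injective hST)
  have hu : IsUniform H r := by
    intro s hs
    obtain ⟨S, rfl⟩ := hpre s hs
    have := encard_star_edge hn hr ((hφ S).1 hs)
    rw [Subtype.val_injective.encard_image, φ.injective.encard_image] at this
    rwa [Subtype.val_injective.encard_image]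
  obtain ⟨E, V, hrep⟩ := exists_rep hV
  refine ⟨hV, hu, (hrep.bergeCycleFree_iff (by omega)).2 ?_, ?_⟩
  · set K : Set α := Subtype.val '' (φ.symm '' (Subtype.val ⁻¹' {j : Fin n | (j : ℕ) < r - 1}))
      with hK
    have hKc : K.encard = (r - 1 : ℕ) := by
      rw [hK, Subtype.val_injective.encard_image, φ.symm.injective.encard_image,
        ← Subtype.val_injective.encard_image, Subtype.image_preimage_coe,
        show V(star n r) = Set.univ from rfl, Set.univ_inter, encard_starCore hn hr]
    obtain ⟨L, hL⟩ := (Set.finite_of_encard_eq_coe hKc).exists_finset_coe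
    rw [← hL, Set.encard_coe_eq_coe_finsetCard] at hKc
    refine cycleFree_of_core hr (hrep.isUniform_iff.1 hu) (K := L) (by exact_mod_cast hKc) ?_
    intro f hf
    have hfH := hrep.mem_iff.2 hf
    rw [← coe_subset, hL]
    obtain ⟨S, hS⟩ := hpre _ hfH
    rw [← hS] at hfH ⊢
    obtain ⟨i, -, hi⟩ := star_mem_iff.1 ((hφ S).1 hfH)
    refine Set.image_mono ?_
    rintro - ⟨j, hj, rfl⟩
    have : (j : Fin n) ∈ Subtype.val '' (φ '' S) := by
      rw [hi]
      exact Set.mem_insert_of_mem _ hj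
    obtain ⟨-, ⟨y, hy, rfl⟩, hyj⟩ := this
    rw [← Subtype.val_injective hyj]
    simpa using hy
  · rw [hb, ← ncard_star hn hr]
    have h1 : E(H) = (fun S : Set V(H) => (Subtype.val '' S : Set α)) ''
        {S | Subtype.val '' S ∈ E(H)} := by
      ext s
      constructor
      · intro hs
        obtain ⟨S, rfl⟩ := hpre s hs
        exact ⟨S, hs, rfl⟩
      · rintro ⟨S, hS, rfl⟩
        exact hS
    have h2 : E(star n r) = (fun S : Set V(H) => (Subtype.val '' (φ '' S) : Set (Fin n))) ''
        {S | Subtype.val '' S ∈ E(H)} := by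
      ext s
      constructor
      · intro hs
        have hs' : Subtype.val '' (φ '' (φ.symm '' (Subtype.val ⁻¹' s))) = s := by
          rw [Equiv.image_symm_image, Subtype.image_preimage_coe, Set.inter_eq_right]
          exact Set.subset_univ s
        refine ⟨φ.symm '' (Subtype.val ⁻¹' s), ?_, hs'⟩
        refine (hφ _).2 ?_
        rwa [hs']
      · rintro ⟨S, hS, rfl⟩
        exact (hφ S).1 hS
    rw [h1, h2, Set.ncard_image_of_injective _ (Set.image_injective.2 Subtype.val_injective),
      Set.ncard_image_of_injective _ hinj]

/-- Every hyperedge is the core plus one vertex, and there are exactly `n + 1 - r` such sets, so by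
counting all of them occur. -/
theorem mem_iff_exists_insert [DecidableEq α] {E : Finset (Finset α)} {V K : Finset α} (hr : 2 < r)
    (hn : r ≤ n) (hEV : ∀ f ∈ E, f ⊆ V) (hV : V.card = n) (hu : ∀ f ∈ E, f.card = r)
    (hK : K.card = r - 1) (hKE : ∀ f ∈ E, K ⊆ f) (hE : E.card = n + 1 - r) (f : Finset α) :
    f ∈ E ↔ ∃ x ∈ V \ K, insert x K = f := by
  have hsub : E ⊆ (V \ K).image fun x => insert x K := by
    intro f hf
    have h1 := card_sdiff_of_subset (hKE f hf)
    rw [hu f hf, hK] at h1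
    obtain ⟨x, hx⟩ := card_eq_one.1 (show (f \ K).card = 1 by omega)
    have hxf : x ∈ f \ K := by simp [hx]
    obtain ⟨hxf, hxK⟩ := mem_sdiff.1 hxf
    refine mem_image.2 ⟨x, mem_sdiff.2 ⟨hEV f hf hxf, hxK⟩, ?_⟩
    rw [insert_eq, ← hx, sdiff_union_of_subset (hKE f hf)]
  obtain ⟨g, hg⟩ := card_pos.1 (show 0 < E.card by omega)
  have hKV : K ⊆ V := (hKE g hg).trans (hEV g hg)
  have := eq_of_subset_of_card_le hsub (card_image_le.trans (by
    rw [card_sdiff_of_subset hKV]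
    omega))
  rw [this, mem_image]

theorem exists_equiv_core {V K : Finset α} (hn : r ≤ n) (hV : V.card = n)
    (hKV : K ⊆ V) (hK : K.card = r - 1) :
    ∃ g : V ≃ Fin n, ∀ x : V, (g x : ℕ) < r - 1 ↔ (x : α) ∈ K := by
  classical
  have hn1 : r - 1 ≤ n := by omega
  set s : Finset (Fin n) := univ.filter fun i => (i : ℕ) < r - 1 with hs
  have hsc : s.card = K.card := by
    rw [hK, Fin.card_filter_val_lt]
    omega
  set k := Finset.equivOfCardEq hsc
  rcases isEmpty_or_nonempty (Fin n) with hem | ⟨⟨i₀⟩⟩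
  · have : V = ∅ := by
      rw [← card_eq_zero, hV]
      rcases n with _ | n
      · rfl
      · exact (hem.false 0).elim
    subst this
    have : n = 0 := by simpa using hV.symm
    subst this
    exact ⟨Equiv.equivOfIsEmpty _ _, fun x => absurd x.2 (notMem_empty _)⟩
  obtain ⟨a, ha⟩ : V.Nonempty := card_pos.1 (by rw [hV]; exact i₀.pos)
  set f : Fin n → α := fun i => if h : i ∈ s then k ⟨i, h⟩ else a with hf
  have hfK : ∀ i ∈ s, f i ∈ K := fun i hi => by
    simp only [hf, hi, dif_pos]
    exact (k _).2
  obtain ⟨g, hg⟩ := Finset.exists_equiv_extend_of_card_eq (α := Fin n) (t := V) (by simp [hV])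
    (s := s) (f := f) (by
      intro y hy
      obtain ⟨i, hi, rfl⟩ := mem_image.1 hy
      exact hKV (hfK i hi)) (by
      intro i hi j hj hij
      have hi := mem_coe.1 hi
      have hj := mem_coe.1 hj
      simp only [hf, hi, hj, dif_pos] at hij
      simpa using k.injective (Subtype.ext hij))
  refine ⟨g.symm, fun x => ?_⟩
  obtain ⟨i, rfl⟩ := g.surjective x
  rw [Equiv.symm_apply_apply]
  have his : i ∈ s ↔ (i : ℕ) < r - 1 := by simp [hs]
  rw [← his]
  constructor
  · intro hi
    rw [hg i hi]
    exact hfK i hi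
  · intro hi
    have hj := (k.symm ⟨g i, hi⟩).2
    have : g (k.symm ⟨g i, hi⟩ : Fin n) = g i := by
      apply Subtype.ext
      rw [hg _ hj]
      simp only [hf, hj, dif_pos]
      simp
    rw [← g.injective this]
    exact hj

theorem isIsomorphic_star_of_core {E : Finset (Finset α)} {V K : Finset α} (h : Rep H E V)
    (hr : 2 < r) (hn : r ≤ n) (hV : V.card = n) (hu : ∀ f ∈ E, f.card = r) (hK : K.card = r - 1)
    (hKE : ∀ f ∈ E, K ⊆ f) (hE : E.card = n + 1 - r) : IsIsomorphic H (star n r) := by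
  classical
  have hmem := mem_iff_exists_insert hr hn h.subset hV hu hK hKE hE
  obtain ⟨f₀, hf₀⟩ := card_pos.1 (show 0 < E.card by omega)
  have hKV : K ⊆ V := (hKE f₀ hf₀).trans (h.subset f₀ hf₀)
  obtain ⟨g, hg⟩ := exists_equiv_core hn hV hKV hK
  have hVmem : ∀ x, x ∈ V(H) ↔ x ∈ V := fun x => by rw [h.vert, mem_coe]
  set ψ : V(H) ≃ Fin n := (Equiv.subtypeEquivRight hVmem).trans g with hψ
  have hψK : ∀ x, (ψ x : ℕ) < r - 1 ↔ (x : α) ∈ K := fun x => hg _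
  obtain ⟨φ, hφ⟩ : ∃ φ : V(H) ≃ V(star n r), ∀ x, (φ x : Fin n) = ψ x :=
    ⟨ψ.trans (Equiv.Set.univ (Fin n)).symm, fun _ => rfl⟩
  refine ⟨φ, fun S => ?_⟩
  have himg : Subtype.val '' (φ '' S) = ψ '' S := by
    rw [Set.image_image]
    exact Set.image_congr fun x _ => hφ x
  have key : ∀ x : V(H), Subtype.val '' S = insert (x : α) (K : Set α) ↔
      ψ '' S = insert (ψ x) {j : Fin n | (j : ℕ) < r - 1} := by
    intro x
    have h1 : Subtype.val '' S = insert (x : α) (K : Set α) ↔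
        ∀ y : V(H), y ∈ S ↔ y = x ∨ (y : α) ∈ K := by
      constructor
      · intro hS y
        rw [← Subtype.val_injective.mem_set_image, hS, Set.mem_insert_iff, mem_coe,
          Subtype.val_inj]
      · intro hS
        ext y
        constructor
        · rintro ⟨y, hy, rfl⟩
          rcases (hS y).1 hy with rfl | hy
          · exact Set.mem_insert _ _
          · exact Set.mem_insert_of_mem _ hy
        · rintro (rfl | hy)
          · exact ⟨x, (hS x).2 (Or.inl rfl), rfl⟩
          · exact ⟨⟨y, (hVmem y).2 (hKV hy)⟩, (hS _).2 (Or.inr hy), rfl⟩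
    have h2 : ψ '' S = insert (ψ x) {j : Fin n | (j : ℕ) < r - 1} ↔
        ∀ y : V(H), y ∈ S ↔ y = x ∨ (y : α) ∈ K := by
      rw [Set.ext_iff, ψ.surjective.forall]
      refine forall_congr' fun y => ?_
      rw [ψ.injective.mem_set_image, Set.mem_insert_iff, ψ.injective.eq_iff, ← hψK]
      rfl
    rw [h1, h2]
  rw [himg, h.edge, star_mem_iff]
  constructor
  · rintro ⟨f, hf, hfS⟩
    obtain ⟨x, hx, rfl⟩ := (hmem f).1 hf
    obtain ⟨hxV, hxK⟩ := mem_sdiff.1 hx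
    refine ⟨ψ ⟨x, (hVmem x).2 hxV⟩, ?_, (key _).1 ?_⟩
    · exact not_lt.1 fun hlt => hxK ((hψK _).1 hlt)
    · rw [← hfS, coe_insert]
  · rintro ⟨i, hi, hS⟩
    obtain ⟨x, rfl⟩ := ψ.surjective i
    refine ⟨insert (x : α) K, (hmem _).2 ⟨x, mem_sdiff.2 ⟨(hVmem _).1 x.2, fun hxK => ?_⟩, rfl⟩, ?_⟩
    · exact absurd ((hψK x).2 hxK) (not_lt.2 hi)
    · rw [coe_insert]
      exact ((key x).2 hS).symm

end Star

/-! ### The main theorem -/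

theorem floor_eq {n r : ℕ} (hn : 0 < n) :
    ⌊((n : ℚ) - 1) / (r : ℚ)⌋ = (((n - 1) / r : ℕ) : ℤ) := by
  obtain ⟨n, rfl⟩ := Nat.exists_eq_succ_of_ne_zero hn.ne'
  rw [Nat.succ_eq_add_one, Nat.cast_add_one, add_sub_cancel_right, Rat.floor_natCast_div_natCast]
  simp

end BergeTuran

theorem mainTheorem1 (r n : ℕ) (hr : 2 < r) (hn : 0 < n) :
    -- the Turán number
    ((BergeTuran.exBerge n r r : ℤ) =
      max (⌊((n : ℚ) - 1) / (r : ℚ)⌋ * ((r : ℤ) - 1)) ((n : ℤ) - r + 1)) ∧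
    -- the star is the unique extremal hypergraph
    (⌊((n : ℚ) - 1) / (r : ℚ)⌋ * ((r : ℤ) - 1) < (n : ℤ) - r + 1 →
      ∀ {α : Type*} (H : Hypergraph α),
        BergeTuran.IsExtremal H n r r ↔
          BergeTuran.IsIsomorphic H (BergeTuran.star n r)) ∧
    -- the block trees are the only extremal hypergraphs
    ((n : ℤ) - r + 1 < ⌊((n : ℚ) - 1) / (r : ℚ)⌋ * ((r : ℤ) - 1) → r ∣ n - 1 →
      ∀ {α : Type*} (H : Hypergraph α),
        BergeTuran.IsExtremal H n r r ↔
          H.vertexSet.encard = n ∧ BergeTuran.IsUniform H r ∧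
            BergeTuran.IsBlockTree H (r + 1) (r - 1)) := by
  classical
  have hex := BergeTuran.exBerge_eq_bound (n := n) hr
  rw [BergeTuran.floor_eq hn, show (r : ℤ) - 1 = ((r - 1 : ℕ) : ℤ) by omega, ← Nat.cast_mul]
  rw [BergeTuran.bound] at hex
  refine ⟨by omega, fun hlt => ?_, fun hlt hdvd => ?_⟩
  · have hlt' : (n - 1) / r * (r - 1) < n + 1 - r := by omega
    intro α H
    refine ⟨?_, BergeTuran.isExtremal_of_isIsomorphic_star hr (by omega) (by omega)⟩
    rintro ⟨hV, hu, hf, hc⟩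
    obtain ⟨E, V, h⟩ := BergeTuran.exists_rep hV
    have hVc := h.encard_eq.1 hV
    have hu' := h.isUniform_iff.1 hu
    have hE : E.card = n + 1 - r := by rw [← h.ncard_edgeSet]; omega
    obtain ⟨K, hK, hKE⟩ := BergeTuran.exists_core_of_card_eq hr hu'
      ((h.bergeCycleFree_iff (by omega)).1 hf) h.subset (by omega) (by rwa [hVc])
    exact BergeTuran.isIsomorphic_star_of_core h hr (by omega) hVc hu' hK hKE hE
  · intro α H
    obtain ⟨q, hq⟩ := hdvd
    have hdiv : (n - 1) / r = q := by rw [hq]; exact Nat.mul_div_cancel_left _ (by omega)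
    have hqr : r * q = q * (r - 1) + q := by
      obtain ⟨s, rfl⟩ := Nat.exists_eq_succ_of_ne_zero (show r ≠ 0 by omega)
      rw [Nat.succ_sub_one, mul_comm, Nat.mul_succ]
    rw [hdiv] at hex hlt
    -- With `n = q * r + 1`, the strict inequality reads `q * r + 2 - r < q * (r - 1)`, that is, `q
    -- + 2 < r`.
    have hq2 : q + 2 < r := by omega
    have hex' : BergeTuran.exBerge n r r = q * (r - 1) := by omega
    constructor
    · rintro ⟨hV, hu, hf, hc⟩
      refine ⟨hV, hu, ?_⟩
      obtain ⟨E, V, h⟩ := BergeTuran.exists_rep hV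
      have hVc := h.encard_eq.1 hV
      have hu' := h.isUniform_iff.1 hu
      have hT := BergeTuran.treeLike_of_card_eq hr hu' ((h.bergeCycleFree_iff (by omega)).1 hf)
        h.subset q hq2 (by rw [mul_comm]; omega) (by rw [← h.ncard_edgeSet]; omega)
      exact h.isBlockTree_iff.2 ⟨hT.conn, fun B hB => hT.block_spec hr hu' hB⟩
    · rintro ⟨hV, hu, hB⟩
      obtain ⟨E, V, h⟩ := BergeTuran.exists_rep hV
      have hVc := h.encard_eq.1 hV
      have hu' := h.isUniform_iff.1 hu
      obtain ⟨hconn, hblock⟩ := h.isBlockTree_iff.1 hB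
      have hfree := BergeTuran.cycleFree_of_blocks hr hu' h.subset fun B hB => (hblock B hB).2
      have hle := BergeTuran.le_card_of_blocks hr hu' h.subset hconn
        (fun B hB => (hblock B hB).1) fun B hB => (hblock B hB).2
      have hge := BergeTuran.card_le_bound hr hu' hfree h.subset
      rw [hVc, hdiv] at hle
      rw [hVc, BergeTuran.bound, hdiv] at hge
      refine ⟨hV, hu, (h.bergeCycleFree_iff (by omega)).2 hfree, ?_⟩
      rw [h.ncard_edgeSet]
      omega
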